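/- Let $n\ge 2$ and let $M=(\mathbb C^n\setminus\{0\})/\langle z\mapsto \tfrac12 z\rangle\cong S^{2n-1}\times S^1$ be the standard Hopf manifold with the complex structure induced from $\mathbb C^n\setminus\{0\}$. Let $\omega_0=\sqrt{-1}\sum_{i,j}\frac{4\delta_{ij}}{|z|^2}\,dz^i\wedge d\bar z^j$ be its canonical metric, which like $\sqrt{-1}\,\partial\bar\partial\log|z|^2$ is invariant under $z\mapsto\frac12 z$ and so descends to $M$. For a Hermitian metric $\omega=\sqrt{-1}\sum h_{i\bar j}dz^i\wedge d\bar z^j$ on a complex manifold and $t\in\mathbb R$, let $\nabla^t=(1-t)\nabla^{\mathrm{Ch}}+t\nabla^{\mathrm{SB}}$ be the Gauduchon connection on $T^{1,0}M$. Here $\nabla^{\mathrm{Ch}}$ is the Chern connection (the connection compatible with $h$ and with the holomorphic structure), and $\nabla^{\mathrm{SB}}$ is the Strominger–Bismut connection (the connection compatible with $h$ and the complex structure whose torsion, lowered with the metric, is totally skew-symmetric). Let $\mathfrak R_{i\bar jk\bar\ell}$ be the curvature components of $\nabla^t$, with the convention $\mathfrak R(X,Y)=[\nabla^t_X,\nabla^t_Y]-\nabla^t_{[X,Y]}$,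 and let $$\mathfrak{Ric}^{(1)}(\omega,t)=\sqrt{-1}\,\sum_{i,j}\Big(\sum_{k,\ell}h^{k\bar\ell}\mathfrak R_{i\bar jk\bar\ell}\Big)dz^i\wedge d\bar z^j$$ be the first Ricci form. Then for every $t>0$ the form $$\omega_t=\omega_0+4\Big(\frac{2(n-1)t}{n}-1\Big)\sqrt{-1}\,\partial\bar\partial\log|z|^2$$ is the fundamental form of a (smooth, positive definite) Hermitian metric on $M$, and $\mathfrak{Ric}^{(1)}(\omega_t,t)=0$, i.e. $\omega_t$ is $t$-Gauduchon–Ricci flat. In particular, for $t=1$ the metric $\omega_1=\omega_0+\frac{4(n-2)}{n}\sqrt{-1}\,\partial\bar\partial\log|z|^2$ is Strominger–Bismut–Ricci flat: the first Ricci form of its Strominger–Bismut connection vanishes. -/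

import Mathlib

open scoped Manifold ContDiff

/-! ## Complex manifolds of dimension `n`, modelled on `ℂⁿ` -/

/-- The model space `ℂⁿ`, with norm `|z|² = ∑ |zⁱ|²`. -/
abbrev Cn (n : ℕ) : Type := EuclideanSpace ℂ (Fin n)

/-- A complex manifold is in particular a real-analytic (hence smooth) manifold. -/
instance isManifold_real_of_complex {n : ℕ} {M : Type*} [TopologicalSpace M]
    [ChartedSpace (Cn n) M] [IsManifold 𝓘(ℂ, Cn n) ω M] :
    IsManifold 𝓘(ℝ, Cn n) ω M := by
  refine isManifold_of_contDiffOn _ _ _ fun e e' he he' => ?_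
  have h := (contDiffGroupoid ω 𝓘(ℂ, Cn n)).compatible he he'
  rw [contDiffGroupoid, mem_groupoid_of_pregroupoid] at h
  exact h.1.restrict_scalars ℝ

/-- The complex structure `J` on the real tangent space `T_p M` of a complex manifold.
The tangent space is identified with `ℂⁿ` through a holomorphic chart at `p`; `J` is
multiplication by `√-1`, which does not depend on the holomorphic chart. -/
noncomputable def complexJ {n : ℕ} {M : Type*} [TopologicalSpace M] [ChartedSpace (Cn n) M]
    (p : M) : TangentSpace 𝓘(ℝ, Cn n) p →L[ℝ] TangentSpace 𝓘(ℝ, Cn n) p :=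
  (Complex.I • ContinuousLinearMap.id ℝ (Cn n) : Cn n →L[ℝ] Cn n)

/-- A Hermitian metric on a complex manifold `(M, J)`: a smooth Riemannian metric `g` with
`g(JX, JY) = g(X, Y)`. -/
structure HermitianMetric (n : ℕ) (M : Type*) [TopologicalSpace M] [ChartedSpace (Cn n) M]
    [IsManifold 𝓘(ℂ, Cn n) ω M] extends
    Bundle.ContMDiffRiemannianMetric 𝓘(ℝ, Cn n) ∞ (Cn n)
      (fun p : M => TangentSpace 𝓘(ℝ, Cn n) p) where
  inner_J : ∀ (p : M) (u v : TangentSpace 𝓘(ℝ, Cn n) p),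
    inner p (complexJ p u) (complexJ p v) = inner p u v

namespace HermitianMetric

variable {n : ℕ} {M : Type*} [TopologicalSpace M] [ChartedSpace (Cn n) M]
  [IsManifold 𝓘(ℂ, Cn n) ω M]

/-- The fundamental form `ω(X, Y) = g(JX, Y)`. -/
noncomputable def fundamentalForm (g : HermitianMetric n M) (p : M)
    (u v : TangentSpace 𝓘(ℝ, Cn n) p) : ℝ :=
  g.inner p (complexJ p u) v

/-- The coordinate vector field `∂/∂xⁱ` of a chart `φ` with `zⁱ = xⁱ + √-1 yⁱ`, at the point with
coordinates `x`. -/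
noncomputable def coordVector (φ : OpenPartialHomeomorph M (Cn n)) (x : Cn n) (i : Fin n) :
    TangentSpace 𝓘(ℝ, Cn n) (φ.symm x) :=
  mfderiv 𝓘(ℝ, Cn n) 𝓘(ℝ, Cn n) φ.symm x (EuclideanSpace.single i (1 : ℂ))

/-- The components `h_{i j̄} = h(∂/∂zⁱ, ∂/∂z̄ʲ) = ½ (g(∂/∂xⁱ, ∂/∂xʲ) + √-1 g(∂/∂xⁱ, J ∂/∂xʲ))`
of the metric in a holomorphic chart `φ`, as functions on `φ.target ⊆ ℂⁿ`. -/
noncomputable def coeff (g : HermitianMetric n M) (φ : OpenPartialHomeomorph M (Cn n))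
    (x : Cn n) : Matrix (Fin n) (Fin n) ℂ :=
  Matrix.of fun i j =>
    ((g.inner (φ.symm x) (coordVector φ x i) (coordVector φ x j) : ℂ) +
      Complex.I *
        (g.inner (φ.symm x) (coordVector φ x i) (complexJ _ (coordVector φ x j)) : ℂ)) / 2

end HermitianMetric

/-! ## Calculus in holomorphic coordinates -/

/-- The derivative `∂f/∂zⁱ = ½ (∂f/∂xⁱ - √-1 ∂f/∂yⁱ)`. -/
noncomputable def dz {n : ℕ} (i : Fin n) (f : Cn n → ℂ) (x : Cn n) : ℂ :=
  (fderiv ℝ f x (EuclideanSpace.single i (1 : ℂ)) -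
    Complex.I * fderiv ℝ f x (EuclideanSpace.single i Complex.I)) / 2

/-- The derivative `∂f/∂z̄ⁱ = ½ (∂f/∂xⁱ + √-1 ∂f/∂yⁱ)`. -/
noncomputable def dzbar {n : ℕ} (i : Fin n) (f : Cn n → ℂ) (x : Cn n) : ℂ :=
  (fderiv ℝ f x (EuclideanSpace.single i (1 : ℂ)) +
    Complex.I * fderiv ℝ f x (EuclideanSpace.single i Complex.I)) / 2

/-- The value on the real tangent vectors `u, v ∈ ℂⁿ` of the `(1,1)`-form
`√-1 ∑ H_{i j̄} dzⁱ ∧ dz̄ʲ`. -/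
noncomputable def oneOneForm {n : ℕ} (H : Matrix (Fin n) (Fin n) ℂ) (u v : Cn n) : ℂ :=
  Complex.I * ∑ i, ∑ j, H i j * (u i * star (v j) - v i * star (u j))

/-- The components `∂²f/∂zⁱ∂z̄ʲ` of `∂∂̄f = ∑ ∂²f/∂zⁱ∂z̄ʲ dzⁱ ∧ dz̄ʲ`. -/
noncomputable def ddbar {n : ℕ} (f : Cn n → ℂ) (x : Cn n) : Matrix (Fin n) (Fin n) ℂ :=
  Matrix.of fun i j => dz i (dzbar j f) x

/-! ## Connections on the holomorphic tangent bundle in a holomorphic chart -/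

/-- An affine connection on `T^{1,0}M` over the domain of a holomorphic chart, given by its
coefficients in the coordinate frame:
`∇_{∂/∂zⁱ} ∂/∂zʲ = ∑ A i j k ∂/∂zᵏ` and `∇_{∂/∂z̄ⁱ} ∂/∂zʲ = ∑ B i j k ∂/∂zᵏ`. -/
structure CoordConnection (n : ℕ) where
  A : Fin n → Fin n → Fin n → Cn n → ℂ
  B : Fin n → Fin n → Fin n → Cn n → ℂ

namespace CoordConnection

variable {n : ℕ}

/-- `∇_{∂/∂zⁱ} s` for a section `s = ∑ sᵏ ∂/∂zᵏ` of `T^{1,0}M`. -/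
noncomputable def nabla (D : CoordConnection n) (i : Fin n) (s : Cn n → Fin n → ℂ) :
    Cn n → Fin n → ℂ :=
  fun x k => dz i (fun y => s y k) x + ∑ j, s x j * D.A i j k x

/-- `∇_{∂/∂z̄ⁱ} s` for a section `s = ∑ sᵏ ∂/∂zᵏ` of `T^{1,0}M`. -/
noncomputable def nablaBar (D : CoordConnection n) (i : Fin n) (s : Cn n → Fin n → ℂ) :
    Cn n → Fin n → ℂ :=
  fun x k => dzbar i (fun y => s y k) x + ∑ j, s x j * D.B i j k x

/-- The coordinate frame field `∂/∂zᵏ`. -/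
def frame (k : Fin n) : Cn n → Fin n → ℂ := fun _ => Pi.single k 1

/-- The curvature `ℜ(∂/∂zⁱ, ∂/∂z̄ʲ) ∂/∂zᵏ = ∇_i ∇_{j̄} ∂/∂zᵏ - ∇_{j̄} ∇_i ∂/∂zᵏ`
(coordinate vector fields commute). -/
noncomputable def curvature (D : CoordConnection n) (i j k : Fin n) : Cn n → Fin n → ℂ :=
  fun x s => D.nabla i (D.nablaBar j (frame k)) x s - D.nablaBar j (D.nabla i (frame k)) x s

/-- `ℜ_{i j̄ k l̄} = h(ℜ(∂/∂zⁱ, ∂/∂z̄ʲ) ∂/∂zᵏ, ∂/∂z̄ˡ)`. -/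
noncomputable def curvatureLow (D : CoordConnection n)
    (h : Cn n → Matrix (Fin n) (Fin n) ℂ) (i j k l : Fin n) (x : Cn n) : ℂ :=
  ∑ s, D.curvature i j k x s * h x s l

/-- The components `h^{k l̄} ℜ_{i j̄ k l̄}` of the first Ricci form `ℜic⁽¹⁾`, where
`∑_l h^{k l̄} h_{s l̄} = δ_{ks}`, i.e. `h^{k l̄}` is the `(l, k)` entry of the inverse matrix. -/
noncomputable def firstRicci (D : CoordConnection n)
    (h : Cn n → Matrix (Fin n) (Fin n) ℂ) (x : Cn n) : Matrix (Fin n) (Fin n) ℂ :=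
  Matrix.of fun i j => ∑ k, ∑ l, (h x)⁻¹ l k * D.curvatureLow h i j k l x

/-- `∇h = 0` on `U`: `∂_i h(∂_j, ∂_{l̄}) = h(∇_i ∂_j, ∂_{l̄}) + h(∂_j, conj (∇_{ī} ∂_l))`.
(The derivatives in the directions `∂/∂z̄ⁱ` give the complex conjugates of these equations.) -/
def IsMetric (D : CoordConnection n) (h : Cn n → Matrix (Fin n) (Fin n) ℂ)
    (U : Set (Cn n)) : Prop :=
  ∀ x ∈ U, ∀ i j l : Fin n, dz i (fun y => h y j l) x =
    (∑ k, D.A i j k x * h x k l) + ∑ k, h x j k * star (D.B i l k x)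

/-- The Chern connection of `h` on `U`: the connection compatible with `h` and with the holomorphic
structure `∂̄` (so that `∇_{∂/∂z̄ⁱ}` annihilates the holomorphic frame). -/
def IsChern (D : CoordConnection n) (h : Cn n → Matrix (Fin n) (Fin n) ℂ)
    (U : Set (Cn n)) : Prop :=
  D.IsMetric h U ∧ ∀ x ∈ U, ∀ i j k : Fin n, D.B i j k x = 0

/-- The component `h(T(∂/∂zⁱ, ∂/∂zʲ), ∂/∂z̄ˡ)` of the torsion `T(X, Y) = ∇_X Y - ∇_Y X - [X, Y]`
of the real connection corresponding to `∇`, which acts on `T^{0,1}M` by conjugation. -/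
noncomputable def torsionA (D : CoordConnection n) (h : Cn n → Matrix (Fin n) (Fin n) ℂ)
    (x : Cn n) (i j l : Fin n) : ℂ :=
  ∑ k, (D.A i j k x - D.A j i k x) * h x k l

/-- The component `h(T(∂/∂z̄ˡ, ∂/∂zⁱ), ∂/∂zʲ)` of the same torsion. Here
`T(∂/∂z̄ˡ, ∂/∂zⁱ) = ∑ B l i k ∂/∂zᵏ - ∑ conj (B i l k) ∂/∂z̄ᵏ`, and only the `(0,1)` part pairs
nontrivially with `∂/∂zʲ`. -/
noncomputable def torsionB (D : CoordConnection n) (h : Cn n → Matrix (Fin n) (Fin n) ℂ)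
    (x : Cn n) (l i j : Fin n) : ℂ :=
  - ∑ k, star (D.B i l k x) * h x j k

/-- The Strominger-Bismut connection of `h` on `U`: the connection compatible with `h` (and with
`J`) whose torsion `h(T(X, Y), Z)` is totally skew-symmetric. The components of this trilinear form
of type `(3,0)` and `(0,3)` vanish, the form is skew in `X, Y`, and it is real, so total
skew-symmetry says that the two components below agree. -/
def IsStromingerBismut (D : CoordConnection n) (h : Cn n → Matrix (Fin n) (Fin n) ℂ)
    (U : Set (Cn n)) : Prop :=
  D.IsMetric h U ∧ ∀ x ∈ U, ∀ i j l : Fin n, D.torsionA h x i j l = D.torsionB h x l i j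

/-- The member `∇ᵗ = (1 - t) ∇ + t ∇'` of the line of connections through `∇` and `∇'`. -/
noncomputable def line (t : ℝ) (D D' : CoordConnection n) : CoordConnection n where
  A i j k x := (1 - t : ℂ) * D.A i j k x + t * D'.A i j k x
  B i j k x := (1 - t : ℂ) * D.B i j k x + t * D'.B i j k x

end CoordConnection

namespace HermitianMetric

variable {n : ℕ} {M : Type*} [TopologicalSpace M] [ChartedSpace (Cn n) M]
  [IsManifold 𝓘(ℂ, Cn n) ω M]

/-- `ℜic⁽¹⁾(ω, t) = 0`: the first Ricci form of the Gauduchon connection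
`∇ᵗ = (1 - t) ∇^Ch + t ∇^SB` vanishes. It is a tensor, so its vanishing is expressed in the
holomorphic charts of an atlas. In each chart, the Chern and the Strominger-Bismut connection exist
(they are unique), and the Ricci form of `∇ᵗ` is zero. -/
def IsGauduchonRicciFlat (g : HermitianMetric n M) (t : ℝ) : Prop :=
  ∀ φ ∈ atlas (Cn n) M,
    (∃ D : CoordConnection n, D.IsChern (g.coeff φ) φ.target) ∧
    (∃ D : CoordConnection n, D.IsStromingerBismut (g.coeff φ) φ.target) ∧
    ∀ Ch SB : CoordConnection n, Ch.IsChern (g.coeff φ) φ.target →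
      SB.IsStromingerBismut (g.coeff φ) φ.target →
      ∀ x ∈ φ.target, ∀ u v : Cn n,
        oneOneForm ((CoordConnection.line t Ch SB).firstRicci (g.coeff φ) x) u v = 0

/-- The first Ricci form of the Strominger-Bismut connection vanishes. -/
def IsStromingerBismutRicciFlat (g : HermitianMetric n M) : Prop :=
  ∀ φ ∈ atlas (Cn n) M,
    (∃ D : CoordConnection n, D.IsStromingerBismut (g.coeff φ) φ.target) ∧
    ∀ SB : CoordConnection n, SB.IsStromingerBismut (g.coeff φ) φ.target →
      ∀ x ∈ φ.target, ∀ u v : Cn n, oneOneForm (SB.firstRicci (g.coeff φ) x) u v = 0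

end HermitianMetric

/-! ## The standard Hopf manifold `S^{2n-1} × S¹ = (ℂⁿ \ {0}) / ⟨z ↦ z/2⟩` -/

/-- `ℂⁿ \ {0}`. -/
def puncturedSpace (n : ℕ) : TopologicalSpace.Opens (Cn n) :=
  ⟨{z | z ≠ 0}, isOpen_ne⟩

/-- The transformation `z ↦ z/2` of `ℂⁿ \ {0}`. -/
noncomputable def halving (n : ℕ) : Equiv.Perm (puncturedSpace n) where
  toFun z := ⟨(2⁻¹ : ℂ) • z.1, smul_ne_zero (by norm_num) z.2⟩
  invFun z := ⟨(2 : ℂ) • z.1, smul_ne_zero (by norm_num) z.2⟩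
  left_inv z := Subtype.ext (by simp [smul_smul])
  right_inv z := Subtype.ext (by simp [smul_smul])

/-- The cyclic group generated by `z ↦ z/2`. -/
noncomputable abbrev HopfGroup (n : ℕ) : Subgroup (Equiv.Perm (puncturedSpace n)) :=
  Subgroup.zpowers (halving n)

theorem halving_zpow (n : ℕ) (k : ℤ) (z : puncturedSpace n) :
    (((halving n) ^ k) z).1 = ((2⁻¹ : ℂ) ^ k) • z.1 := by
  induction k using Int.induction_on generalizing z with
  | zero => simp
  | succ k ih =>
    rw [zpow_add_one, Equiv.Perm.mul_apply, ih, zpow_add_one₀ (by norm_num), mul_smul]; rfl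
  | pred k ih =>
    rw [zpow_sub_one, Equiv.Perm.mul_apply, ih, zpow_sub_one₀ (by norm_num), mul_smul, inv_inv]; rfl

theorem hopfGroup_smul {n : ℕ} (g : HopfGroup n) :
    ∃ k : ℤ, g.1 = halving n ^ k ∧
      ∀ z : puncturedSpace n, (g • z).1 = ((2⁻¹ : ℂ) ^ k) • z.1 := by
  obtain ⟨k, hk⟩ := Subgroup.mem_zpowers_iff.1 g.2
  exact ⟨k, hk.symm, fun z => by rw [← halving_zpow, hk]; rfl⟩

instance hopfGroup_continuousConstSMul (n : ℕ) :
    ContinuousConstSMul (HopfGroup n) (puncturedSpace n) where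
  continuous_const_smul g := by
    obtain ⟨k, -, hk⟩ := hopfGroup_smul g
    rw [continuous_induced_rng]
    have : (Subtype.val ∘ fun z : puncturedSpace n => g • z) =
        fun z : puncturedSpace n => ((2⁻¹ : ℂ) ^ k) • z.1 := funext hk
    rw [this]
    fun_prop

instance hopfGroup_isCancelSMul (n : ℕ) : IsCancelSMul (HopfGroup n) (puncturedSpace n) where
  right_cancel' g h z hgh := by
    obtain ⟨k, hk, hk'⟩ := hopfGroup_smul g
    obtain ⟨l, hl, hl'⟩ := hopfGroup_smul h
    have h1 : ((2⁻¹ : ℂ) ^ k) • z.1 = ((2⁻¹ : ℂ) ^ l) • z.1 := by rw [← hk', ← hl', hgh]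
    have h2 : (2⁻¹ : ℂ) ^ k = (2⁻¹ : ℂ) ^ l := smul_left_injective ℂ z.2 h1
    have h3 : (2⁻¹ : ℝ) ^ k = (2⁻¹ : ℝ) ^ l := by simpa using congrArg norm h2
    have h4 : k = l := zpow_right_injective₀ (by norm_num) (by norm_num) h3
    exact Subtype.ext (by rw [hk, hl, h4])

instance hopfGroup_properlyDiscontinuousSMul (n : ℕ) :
    ProperlyDiscontinuousSMul (HopfGroup n) (puncturedSpace n) where
  finite_disjoint_inter_image {K L} hK hL := by
    have hn : Continuous fun z : puncturedSpace n => ‖z.1‖ := by fun_prop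
    have hpos : ∀ z : puncturedSpace n, 0 < ‖z.1‖ := fun z => norm_pos_iff.2 z.2
    rcases K.eq_empty_or_nonempty with rfl | hKne
    · simp
    rcases L.eq_empty_or_nonempty with rfl | hLne
    · simp
    obtain ⟨a, -, ha⟩ := hK.exists_isMinOn hKne hn.continuousOn
    obtain ⟨b, -, hb⟩ := hK.exists_isMaxOn hKne hn.continuousOn
    obtain ⟨c, -, hc⟩ := hL.exists_isMinOn hLne hn.continuousOn
    obtain ⟨d, -, hd⟩ := hL.exists_isMaxOn hLne hn.continuousOn
    obtain ⟨N, hN⟩ := pow_unbounded_of_one_lt (‖b.1‖ / ‖c.1‖) (one_lt_two (α := ℝ))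
    obtain ⟨N', hN'⟩ := pow_unbounded_of_one_lt (‖d.1‖ / ‖a.1‖) (one_lt_two (α := ℝ))
    rw [div_lt_iff₀ (hpos _)] at hN hN'
    refine ((Set.finite_Icc (-(N' : ℤ)) N).image
      (fun k => (⟨halving n ^ k, Subgroup.zpow_mem_zpowers _ k⟩ : HopfGroup n))).subset ?_
    rintro g ⟨_, ⟨z, hz, rfl⟩, hzL⟩
    obtain ⟨k, hk, hk'⟩ := hopfGroup_smul g
    refine ⟨k, ?_, Subtype.ext hk.symm⟩
    have h1 : ‖(g • z).1‖ = (2 : ℝ) ^ (-k) * ‖z.1‖ := by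
      rw [hk', norm_smul]; simp
    have e1 : ‖a.1‖ ≤ ‖z.1‖ := ha hz
    have e2 : ‖z.1‖ ≤ ‖b.1‖ := hb hz
    have e3 : ‖c.1‖ ≤ ‖(g • z).1‖ := hc hzL
    have e4 : ‖(g • z).1‖ ≤ ‖d.1‖ := hd hzL
    constructor
    · by_contra! hlt
      have : (2 : ℝ) ^ N' ≤ (2 : ℝ) ^ (-k) := by
        rw [← zpow_natCast]; exact zpow_le_zpow_right₀ one_le_two (by omega)
      have := mul_le_mul this e1 (hpos a).le (by positivity)
      linarith
    · by_contra! hlt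
      have : (2 : ℝ) ^ N ≤ (2 : ℝ) ^ k := by
        rw [← zpow_natCast]; exact zpow_le_zpow_right₀ one_le_two (by omega)
      have h5 := mul_le_mul this e3 (hpos c).le (by positivity)
      rw [h1, ← mul_assoc, ← zpow_add₀ two_ne_zero] at h5
      simp at h5
      linarith

instance puncturedSpace_locallyCompactSpace (n : ℕ) : LocallyCompactSpace (puncturedSpace n) :=
  (puncturedSpace n).2.locallyCompactSpace

/-- The standard Hopf manifold, with the quotient topology and the charts induced from
`ℂⁿ \ {0}` by local sections of the covering `ℂⁿ \ {0} → M`. -/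
abbrev HopfManifold (n : ℕ) : Type :=
  MulAction.orbitRel.Quotient (HopfGroup n) (puncturedSpace n)

/-- The covering map `ℂⁿ \ {0} → M`. -/
noncomputable def hopfMk (n : ℕ) (z : puncturedSpace n) : HopfManifold n :=
  Quotient.mk (MulAction.orbitRel (HopfGroup n) (puncturedSpace n)) z

/-- The inverse of a chart of the Hopf manifold is the restriction of the covering map. -/
theorem hopf_chart_symm {n : ℕ} {e : OpenPartialHomeomorph (HopfManifold n) (Cn n)}
    (he : e ∈ atlas (Cn n) (HopfManifold n)) {x : Cn n} (hx : x ∈ e.target) :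
    ∃ z : puncturedSpace n, z.1 = x ∧ e.symm x = hopfMk n z := by
  have key : ∀ (hf : IsLocalHomeomorph (hopfMk n)) (p : puncturedSpace n),
      x ∈ ((hf.localInverseAt p).trans (chartAt (Cn n) p)).target →
      ∃ z : puncturedSpace n, z.1 = x ∧
        ((hf.localInverseAt p).trans (chartAt (Cn n) p)).symm x = hopfMk n z := by
    intro hf p hp
    rw [OpenPartialHomeomorph.trans_target] at hp
    refine ⟨(chartAt (Cn n) p).symm x, (chartAt (Cn n) p).right_inv hp.1, ?_⟩
    rw [OpenPartialHomeomorph.coe_trans_symm, Function.comp_apply,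
      IsLocalHomeomorph.localInverseAt_symm]
  obtain ⟨q, rfl⟩ := he
  exact key _ _ hx

/-- The Hopf manifold is a complex manifold. -/
instance hopf_isManifold (n : ℕ) : IsManifold 𝓘(ℂ, Cn n) ω (HopfManifold n) := by
  refine isManifold_of_contDiffOn _ _ _ fun e e' he he' => ?_
  intro x hx
  have hx1 : x ∈ e.target := by simpa using hx.1.1
  have hx2 : e.symm x ∈ e'.source := by simpa using hx.1.2
  obtain ⟨z, rfl, hz⟩ := hopf_chart_symm he hx1
  obtain ⟨w, hw, hw'⟩ := hopf_chart_symm he' (e'.map_source hx2)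
  rw [e'.left_inv hx2, hz] at hw'
  obtain ⟨g, hg⟩ : ∃ g : HopfGroup n, g • z = w := by
    have := Quotient.exact hw'.symm
    exact this
  obtain ⟨k, -, hk⟩ := hopfGroup_smul g
  have hcont : Continuous fun y : Cn n => ((2⁻¹ : ℂ) ^ k) • y := by fun_prop
  have hmem : ((2⁻¹ : ℂ) ^ k) • z.1 ∈ e'.target := by
    rw [← hk, hg, hw]; exact e'.map_source hx2
  have hev : ∀ᶠ y in nhds z.1, y ∈ e.target ∧ ((2⁻¹ : ℂ) ^ k) • y ∈ e'.target :=
    Filter.Eventually.and (e.open_target.mem_nhds hx1)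
      (hcont.continuousAt.preimage_mem_nhds (e'.open_target.mem_nhds hmem))
  have heq : (fun y => e' (e.symm y)) =ᶠ[nhds z.1] fun y => ((2⁻¹ : ℂ) ^ k) • y := by
    filter_upwards [hev] with y hy
    obtain ⟨a, rfl, ha⟩ := hopf_chart_symm he hy.1
    obtain ⟨b, hb, hb'⟩ := hopf_chart_symm he' hy.2
    have hab : b = g • a := Subtype.ext (by rw [hb, hk])
    have : hopfMk n b = hopfMk n a := Quotient.sound ⟨g, hab.symm⟩
    change e' (e.symm a.1) = _
    rw [ha, ← this, ← hb', e'.right_inv hy.2]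
  have hsm : ContDiffAt ℂ ω (fun y : Cn n => ((2⁻¹ : ℂ) ^ k) • y) z.1 := by fun_prop
  exact (hsm.congr_of_eventuallyEq heq).contDiffWithinAt

/-- The components of the `(1,1)`-form `ω₀ + c √-1 ∂∂̄ log |z|²` on `ℂⁿ \ {0}`, where
`ω₀ = √-1 ∑ (4 δ_{ij} / |z|²) dzⁱ ∧ dz̄ʲ`. -/
noncomputable def hopfCoeff (n : ℕ) (c : ℝ) (z : Cn n) : Matrix (Fin n) (Fin n) ℂ :=
  ((4 / ‖z‖ ^ 2 : ℝ) : ℂ) • (1 : Matrix (Fin n) (Fin n) ℂ) +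
    (c : ℂ) • ddbar (fun w : Cn n => ((Real.log (‖w‖ ^ 2) : ℝ) : ℂ)) z

/-- The fundamental form of the Hermitian metric `g` on the Hopf manifold is the one induced by
`ω₀ + c √-1 ∂∂̄ log |z|²`, i.e. its pullback to `ℂⁿ \ {0}` is this form. -/
def IsHopfMetric {n : ℕ} (g : HermitianMetric n (HopfManifold n)) (c : ℝ) : Prop :=
  ∀ (z : puncturedSpace n) (u v : TangentSpace 𝓘(ℝ, Cn n) z),
    (g.fundamentalForm (hopfMk n z)
      (mfderiv 𝓘(ℝ, Cn n) 𝓘(ℝ, Cn n) (hopfMk n) z u)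
      (mfderiv 𝓘(ℝ, Cn n) 𝓘(ℝ, Cn n) (hopfMk n) z v) : ℂ) =
    oneOneForm (hopfCoeff n c z.1) u v

/-! Put `a = 4 + c`. Upstairs on `ℂⁿ \ {0}` the form `ω₀ + c √-1 ∂∂̄ log |z|²` has coefficient
matrix `hopfMatrix n a`: it equals `4 / |z|²` on the complex radial line and `a / |z|²` on the
orthogonal complement, so it is positive definite exactly when `a > 0` (as `n ≥ 2`). It is invariant
under homotheties, hence descends to the Hopf manifold.

The first Ricci form is the trace of the curvature over the endomorphism indices, so only the traces
of the connection coefficients matter (`firstRicci_apply`): it is `∂_i (tr B_j) - ∂̄_j (tr A_i)`.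
For the Chern connection `tr A` is `∂ log det h = -n ∂ log |z|²` and `tr B = 0`. Skew torsion forces
the Strominger-Bismut `A` to be the Chern `A` with its two lower indices exchanged, and `tr B` to be
the conjugate of the difference of the two `A` traces. All traces are thus multiples of `∂ log |z|²`
or its conjugate. Interpolating with weight `t` gives the Ricci form `(n - 8t(n-1)/a) √-1 ∂∂̄ log
|z|²` (`firstRicci_line_hopfMatrix`), which vanishes for `a = 8t(n-1)/n`. This is the stated `c = a
- 4`, and `a > 0` when `t > 0`.

Every chart in the atlas inverts a restriction of the covering map, so the metric coefficients in
any chart are `hopfMatrix` itself (`IsHopfMetric.coeff_eq`) and the computation upstairs suffices.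
-/

/-! ### Wirtinger calculus and the derivatives of `|z|²` and `log |z|²`. -/

section Calculus

variable {n : ℕ} {f g : Cn n → ℂ} {x : Cn n}

theorem dz_congr (i : Fin n) (h : f =ᶠ[nhds x] g) : dz i f x = dz i g x := by
  simp only [dz, h.fderiv_eq]

theorem dzbar_congr (i : Fin n) (h : f =ᶠ[nhds x] g) : dzbar i f x = dzbar i g x := by
  simp only [dzbar, h.fderiv_eq]

theorem dz_const (i : Fin n) (c : ℂ) : dz i (fun _ => c) x = 0 := by simp [dz]

theorem dzbar_const (i : Fin n) (c : ℂ) : dzbar i (fun _ => c) x = 0 := by simp [dzbar]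

theorem dz_sub (i : Fin n) (hf : DifferentiableAt ℝ f x) (hg : DifferentiableAt ℝ g x) :
    dz i (fun y => f y - g y) x = dz i f x - dz i g x := by
  simp only [dz, fderiv_fun_sub hf hg, _root_.sub_apply]; ring

theorem dz_mul (i : Fin n) (hf : DifferentiableAt ℝ f x) (hg : DifferentiableAt ℝ g x) :
    dz i (fun y => f y * g y) x = dz i f x * g x + f x * dz i g x := by
  simp only [dz, fderiv_fun_mul hf hg, _root_.add_apply,
    _root_.smul_apply, smul_eq_mul]
  ring

theorem dz_sum {ι : Type*} (s : Finset ι) {F : ι → Cn n → ℂ} (i : Fin n)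
    (hF : ∀ k ∈ s, DifferentiableAt ℝ (F k) x) :
    dz i (fun y => ∑ k ∈ s, F k y) x = ∑ k ∈ s, dz i (F k) x := by
  simp only [dz, fderiv_fun_sum hF, _root_.sum_apply, Finset.mul_sum,
    ← Finset.sum_sub_distrib, Finset.sum_div]

theorem dz_star (i : Fin n) : dz i (fun y => star (f y)) x = star (dzbar i f x) := by
  have h : fderiv ℝ (fun y => star (f y)) x =
      (Complex.conjCLE : ℂ →L[ℝ] ℂ).comp (fderiv ℝ f x) :=
    Complex.conjCLE.comp_fderiv
  rw [dz, dzbar, h]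
  simp [sub_eq_add_neg]

theorem dzbar_star (i : Fin n) : dzbar i (fun y => star (f y)) x = star (dz i f x) := by
  have := dz_star (f := fun y => star (f y)) (x := x) i
  simp only [star_star] at this
  rw [this, star_star]

theorem dzbar_sum {ι : Type*} (s : Finset ι) {F : ι → Cn n → ℂ} (i : Fin n)
    (hF : ∀ k ∈ s, DifferentiableAt ℝ (F k) x) :
    dzbar i (fun y => ∑ k ∈ s, F k y) x = ∑ k ∈ s, dzbar i (F k) x := by
  simp only [dzbar, fderiv_fun_sum hF, _root_.sum_apply, Finset.mul_sum,
    ← Finset.sum_add_distrib, Finset.sum_div]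

theorem dz_const_mul (i : Fin n) (c : ℂ) (hf : DifferentiableAt ℝ f x) :
    dz i (fun y => c * f y) x = c * dz i f x := by
  rw [dz_mul i (differentiableAt_const c) hf, dz_const]; ring

theorem dzbar_const_mul (i : Fin n) (c : ℂ) (hf : DifferentiableAt ℝ f x) :
    dzbar i (fun y => c * f y) x = c * dzbar i f x := by
  simp only [dzbar, fderiv_const_mul hf, _root_.smul_apply, smul_eq_mul]
  ring

theorem dz_inv (i : Fin n) (hf : DifferentiableAt ℝ f x) (h0 : f x ≠ 0) :
    dz i (fun y => (f y)⁻¹) x = -dz i f x / f x ^ 2 := by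
  have h1 : DifferentiableAt ℝ (fun y => (f y)⁻¹) x := hf.inv h0
  have h2 : dz i (fun y => f y * (f y)⁻¹) x = 0 := by
    rw [← dz_const (x := x) i 1]
    refine dz_congr i ?_
    filter_upwards [hf.continuousAt.eventually_ne h0] with y hy
    exact mul_inv_cancel₀ hy
  rw [dz_mul i hf h1] at h2
  field_simp at h2 ⊢
  linear_combination h2

theorem hasFDerivAt_coord (j : Fin n) :
    HasFDerivAt (fun y : Cn n => y j)
      ((EuclideanSpace.proj j : Cn n →L[ℂ] ℂ).restrictScalars ℝ) x :=
  ((EuclideanSpace.proj j : Cn n →L[ℂ] ℂ).restrictScalars ℝ).hasFDerivAt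

@[fun_prop]
theorem differentiableAt_coord (j : Fin n) : DifferentiableAt ℝ (fun y : Cn n => y j) x :=
  (hasFDerivAt_coord j).differentiableAt

@[fun_prop]
theorem DifferentiableAt.star_complex (hf : DifferentiableAt ℝ f x) :
    DifferentiableAt ℝ (fun y => star (f y)) x :=
  Complex.conjCLE.differentiableAt.comp x hf

theorem dz_coord (i j : Fin n) : dz i (fun y : Cn n => y j) x = if i = j then 1 else 0 := by
  rw [dz, (hasFDerivAt_coord j).fderiv]
  by_cases h : i = j
  · subst h; simp
  · simp [h, Ne.symm h]

theorem dzbar_coord (i j : Fin n) : dzbar i (fun y : Cn n => y j) x = 0 := by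
  rw [dzbar, (hasFDerivAt_coord j).fderiv]
  by_cases h : i = j
  · subst h; simp
  · simp [Ne.symm h]

theorem dz_star_coord (i j : Fin n) : dz i (fun y : Cn n => star (y j)) x = 0 := by
  rw [dz_star, dzbar_coord, star_zero]

/-- The function `|z|²`, with complex values. -/
noncomputable def sqNorm {n : ℕ} (z : Cn n) : ℂ := ((‖z‖ ^ 2 : ℝ) : ℂ)

theorem sqNorm_eq_sum (z : Cn n) : sqNorm z = ∑ k, z k * star (z k) := by
  rw [sqNorm, EuclideanSpace.norm_sq_eq, Complex.ofReal_sum]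
  refine Finset.sum_congr rfl fun k _ => ?_
  exact (Complex.mul_conj' (z k)).symm ▸ by push_cast; rfl

theorem sqNorm_ne_zero {z : Cn n} (hz : z ≠ 0) : sqNorm z ≠ 0 := by
  simp [sqNorm, hz]

theorem star_sqNorm (z : Cn n) : star (sqNorm z) = sqNorm z := Complex.conj_ofReal _

@[fun_prop]
theorem differentiableAt_sqNorm : DifferentiableAt ℝ (sqNorm : Cn n → ℂ) x := by
  have : (sqNorm : Cn n → ℂ) = fun z => ∑ k, z k * star (z k) := funext sqNorm_eq_sum
  rw [this]
  fun_prop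

theorem dz_sqNorm (i : Fin n) : dz i (sqNorm : Cn n → ℂ) x = star (x i) := by
  have : (sqNorm : Cn n → ℂ) = fun z => ∑ k, z k * star (z k) := funext sqNorm_eq_sum
  rw [this, dz_sum _ _ fun k _ => by fun_prop]
  simp_rw [dz_mul i (differentiableAt_coord _) (differentiableAt_coord _).star_complex, dz_coord,
    dz_star_coord]
  simp

theorem dzbar_sqNorm (i : Fin n) : dzbar i (sqNorm : Cn n → ℂ) x = x i := by
  have h := dz_star (f := (sqNorm : Cn n → ℂ)) (x := x) i
  simp only [star_sqNorm] at h
  rw [← star_star (dzbar i _ x), ← h]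
  exact (congrArg star (dz_sqNorm i)).trans (star_star _)

theorem dzbar_log_sqNorm (hx : x ≠ 0) (j : Fin n) :
    dzbar j (fun w : Cn n => ((Real.log (‖w‖ ^ 2) : ℝ) : ℂ)) x = x j * (sqNorm x)⁻¹ := by
  have hx' : ‖x‖ ^ 2 ≠ 0 := by simpa using hx
  have hd : DifferentiableAt ℝ (fun w : Cn n => ‖w‖ ^ 2) x := by
    have : (fun w : Cn n => ‖w‖ ^ 2) = fun w => Complex.reCLM (sqNorm w) :=
      funext fun w => (Complex.ofReal_re _).symm
    rw [this]; fun_prop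
  -- `h1` and `h2` express both differentials through the same real one; they differ only by the
  -- factor `1 / |x|²`, so the known `∂̄|z|²` gives the result.
  have h1 : HasFDerivAt (fun w : Cn n => ((Real.log (‖w‖ ^ 2) : ℝ) : ℂ))
      (Complex.ofRealCLM.comp ((‖x‖ ^ 2)⁻¹ • fderiv ℝ (fun w : Cn n => ‖w‖ ^ 2) x)) x :=
    Complex.ofRealCLM.hasFDerivAt.comp x (hd.hasFDerivAt.log hx')
  have h2 : HasFDerivAt (sqNorm : Cn n → ℂ)
      (Complex.ofRealCLM.comp (fderiv ℝ (fun w : Cn n => ‖w‖ ^ 2) x)) x :=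
    Complex.ofRealCLM.hasFDerivAt.comp x hd.hasFDerivAt
  have h3 := dzbar_sqNorm (x := x) j
  rw [dzbar, h2.fderiv] at h3
  rw [dzbar, h1.fderiv, ← h3]
  simp [sqNorm]
  ring

theorem dz_coord_mul_inv_sqNorm (hx : x ≠ 0) (i j : Fin n) :
    dz i (fun y : Cn n => y j * (sqNorm y)⁻¹) x =
      (if i = j then 1 else 0) / sqNorm x - star (x i) * x j / sqNorm x ^ 2 := by
  have h0 := sqNorm_ne_zero hx
  have h1 : DifferentiableAt ℝ (fun y : Cn n => (sqNorm y)⁻¹) x := differentiableAt_sqNorm.inv h0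
  rw [dz_mul i (differentiableAt_coord j) h1, dz_coord,
    dz_inv i differentiableAt_sqNorm h0, dz_sqNorm]
  ring

theorem dzbar_star_coord_mul_inv_sqNorm (hx : x ≠ 0) (i j : Fin n) :
    dzbar j (fun y : Cn n => star (y i) * (sqNorm y)⁻¹) x =
      (if i = j then 1 else 0) / sqNorm x - star (x i) * x j / sqNorm x ^ 2 := by
  have h : (fun y : Cn n => star (y i) * (sqNorm y)⁻¹) =
      fun y : Cn n => star (y i * (sqNorm y)⁻¹) := by
    funext y; rw [star_mul', star_inv₀, star_sqNorm]
  rw [h, dzbar_star, dz_coord_mul_inv_sqNorm hx]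
  simp only [star_sub, star_div₀, star_mul', star_pow, star_sqNorm, star_star, apply_ite star,
    star_one, star_zero, eq_comm (a := i)]
  ring

theorem ddbar_log_sqNorm (hx : x ≠ 0) (i j : Fin n) :
    ddbar (fun w : Cn n => ((Real.log (‖w‖ ^ 2) : ℝ) : ℂ)) x i j =
      (if i = j then 1 else 0) / sqNorm x - star (x i) * x j / sqNorm x ^ 2 := by
  rw [← dz_coord_mul_inv_sqNorm hx]
  refine dz_congr i ?_
  filter_upwards [isOpen_ne.mem_nhds hx] with y hy
  exact dzbar_log_sqNorm hy j

end Calculus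

/-! ### The coefficient matrix: inverse, derivatives and the two traces. -/

section HopfForm

variable {n : ℕ} {x : Cn n}

/-- The coefficients `a δ_{ij} / |z|² - (a - 4) z̄ᵢ zⱼ / |z|⁴` of `ω₀ + (a - 4) √-1 ∂∂̄ log |z|²`. -/
noncomputable def hopfMatrix (n : ℕ) (a : ℝ) (z : Cn n) : Matrix (Fin n) (Fin n) ℂ :=
  Matrix.of fun i j =>
    a * (if i = j then 1 else 0) * (sqNorm z)⁻¹ - (a - 4) * (star (z i) * z j) * (sqNorm z)⁻¹ ^ 2

theorem hopfCoeff_eq_hopfMatrix (c : ℝ) (hx : x ≠ 0) :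
    hopfCoeff n c x = hopfMatrix n (4 + c) x := by
  ext i j
  simp only [hopfCoeff, Matrix.add_apply, Matrix.smul_apply, ddbar_log_sqNorm hx, hopfMatrix,
    Matrix.of_apply, Matrix.one_apply, smul_eq_mul]
  rw [show ((4 / ‖x‖ ^ 2 : ℝ) : ℂ) = 4 / sqNorm x by simp [sqNorm]]
  push_cast
  ring

/-- The inverse of `hopfMatrix`. -/
noncomputable def hopfMatrixInv (n : ℕ) (a : ℝ) (z : Cn n) : Matrix (Fin n) (Fin n) ℂ :=
  Matrix.of fun i j =>
    (sqNorm z) / a * (if i = j then 1 else 0) + (a - 4) / (4 * a) * (star (z i) * z j)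

/-- The eigenvalues `a / |x|²` and `4 / |x|²` are inverted separately: on the radial line `|x|²/a +
(a-4)|x|²/(4a) = |x|²/4`. -/
theorem hopfMatrix_mul_inv {a : ℝ} (ha : a ≠ 0) (hx : x ≠ 0) :
    hopfMatrix n a x * hopfMatrixInv n a x = 1 := by
  have h0 := sqNorm_ne_zero hx
  have ha' : (a : ℂ) ≠ 0 := by exact_mod_cast ha
  ext i j
  -- The rank-one matrix `P = (x̄ᵢ xⱼ)` satisfies `P² = |x|² P`; this makes the rank-one terms of
  -- the product cancel.
  have hs : ∑ k, star (x i) * x k * (star (x k) * x j) = star (x i) * x j * sqNorm x := by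
    rw [sqNorm_eq_sum, Finset.mul_sum]
    exact Finset.sum_congr rfl fun k _ => by ring
  have : (hopfMatrix n a x * hopfMatrixInv n a x) i j =
      (if i = j then 1 else 0) + (a - 4) / 4 * (sqNorm x)⁻¹ * (star (x i) * x j)
      - (a - 4) / a * (sqNorm x)⁻¹ * (star (x i) * x j)
      - (a - 4) ^ 2 / (4 * a) * (sqNorm x)⁻¹ ^ 2 *
        ∑ k, star (x i) * x k * (star (x k) * x j) := by
    simp only [Matrix.mul_apply, hopfMatrix, hopfMatrixInv, Matrix.of_apply]
    have hk : ∀ k, (a * (if i = k then (1 : ℂ) else 0) * (sqNorm x)⁻¹ -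
          (a - 4) * (star (x i) * x k) * (sqNorm x)⁻¹ ^ 2) *
        (sqNorm x / a * (if k = j then 1 else 0) + (a - 4) / (4 * a) * (star (x k) * x j)) =
        (if i = k then (if k = j then 1 else 0) else 0)
        + (if i = k then (a - 4) / 4 * (sqNorm x)⁻¹ * (star (x k) * x j) else 0)
        - (if k = j then (a - 4) / a * (sqNorm x)⁻¹ * (star (x i) * x k) else 0)
        - (a - 4) ^ 2 / (4 * a) * (sqNorm x)⁻¹ ^ 2 *
          (star (x i) * x k * (star (x k) * x j)) := by
      intro k
      split_ifs <;> field_simp <;> ring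
    simp only [hk, Finset.sum_sub_distrib, Finset.sum_add_distrib, Finset.mul_sum]
    simp
  rw [this, hs, Matrix.one_apply]
  field_simp
  ring

theorem star_hopfMatrix (a : ℝ) (i j : Fin n) :
    star (hopfMatrix n a x i j) = hopfMatrix n a x j i := by
  simp only [hopfMatrix, Matrix.of_apply, star_sub, star_mul', star_pow, star_inv₀, star_sqNorm,
    star_star, apply_ite star, star_one, star_zero, eq_comm (a := i)]
  simp [mul_comm (x i)]

@[fun_prop]
theorem differentiableAt_hopfMatrix (a : ℝ) (hx : x ≠ 0) (i j : Fin n) :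
    DifferentiableAt ℝ (fun y => hopfMatrix n a y i j) x := by
  have h0 : DifferentiableAt ℝ (fun y : Cn n => (sqNorm y)⁻¹) x :=
    differentiableAt_sqNorm.inv (sqNorm_ne_zero hx)
  simp only [hopfMatrix, Matrix.of_apply]
  fun_prop

/-- The last term is symmetric in `k` and `i`, and the delta terms trade places under the swap. The
antisymmetrization, which is the lowered Chern torsion, is therefore `-4 (δ_{il} x̄ₖ - δ_{kl} x̄ᵢ) /
|x|⁴`, independent of `a`. -/
theorem dz_hopfMatrix (a : ℝ) (hx : x ≠ 0) (k i l : Fin n) :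
    dz k (fun y => hopfMatrix n a y i l) x =
      -a * (if i = l then 1 else 0) * star (x k) / sqNorm x ^ 2 -
      (a - 4) * star (x i) * (if k = l then 1 else 0) / sqNorm x ^ 2 +
      2 * (a - 4) * star (x i) * x l * star (x k) / sqNorm x ^ 3 := by
  have h0 : DifferentiableAt ℝ (fun y : Cn n => (sqNorm y)⁻¹) x :=
    differentiableAt_sqNorm.inv (sqNorm_ne_zero hx)
  have hN := sqNorm_ne_zero hx
  simp only [hopfMatrix, Matrix.of_apply, pow_two]
  rw [dz_sub k (by fun_prop) (by fun_prop), dz_const_mul k _ h0,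
    dz_mul k (by fun_prop) (by fun_prop), dz_const_mul k _ (by fun_prop),
    dz_mul k (by fun_prop) (by fun_prop), dz_mul k h0 h0,
    dz_inv k differentiableAt_sqNorm hN, dz_sqNorm, dz_coord, dz_star_coord]
  field_simp
  ring

/-- The inverse is a multiple of the identity plus a radial rank-one term, so contraction with it
needs only the plain trace and the radial contraction: these are `h1` and `h2` in the two trace
computations. -/
theorem sum_mul_hopfMatrixInv (a : ℝ) (T : Fin n → Fin n → ℂ) :
    ∑ k, ∑ l, T k l * hopfMatrixInv n a x l k =
      sqNorm x / a * ∑ k, T k k + (a - 4) / (4 * a) * ∑ k, ∑ l, T k l * (star (x l) * x k) := by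
  have h : ∀ k l, T k l * hopfMatrixInv n a x l k =
      (if l = k then sqNorm x / a * T k l else 0) +
        (a - 4) / (4 * a) * (T k l * (star (x l) * x k)) := by
    intro k l
    simp only [hopfMatrixInv, Matrix.of_apply]
    split_ifs <;> ring
  simp only [h, Finset.sum_add_distrib, ← Finset.mul_sum, Finset.sum_ite_eq', Finset.mem_univ,
    if_true]

/-- The trace of the `(1,0)` part of the Chern connection of `hopfMatrix`, `∂ log det h`. -/
theorem sum_dz_hopfMatrix_mul_inv {a : ℝ} (ha : a ≠ 0) (hx : x ≠ 0) (i : Fin n) :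
    ∑ k, ∑ l, dz i (fun y => hopfMatrix n a y k l) x * hopfMatrixInv n a x l k =
      -n * (star (x i) * (sqNorm x)⁻¹) := by
  have hN := sqNorm_ne_zero hx
  have ha' : (a : ℂ) ≠ 0 := by exact_mod_cast ha
  have h1 : ∑ k, dz i (fun y => hopfMatrix n a y k k) x =
      -a * star (x i) / sqNorm x ^ 2 * n - (a - 4) * star (x i) / sqNorm x ^ 2
      + 2 * (a - 4) * star (x i) / sqNorm x ^ 3 * sqNorm x := by
    have h : ∀ k, dz i (fun y => hopfMatrix n a y k k) x =
        -a * star (x i) / sqNorm x ^ 2 -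
        (if i = k then (a - 4) * star (x k) / sqNorm x ^ 2 else 0)
        + 2 * (a - 4) * star (x i) / sqNorm x ^ 3 * (x k * star (x k)) := by
      intro k
      rw [dz_hopfMatrix a hx, if_pos (rfl : k = k)]
      split_ifs <;> ring
    simp only [h, Finset.sum_add_distrib, Finset.sum_sub_distrib, ← Finset.mul_sum,
      ← sqNorm_eq_sum]
    simp
    ring
  have h2 : ∑ k, ∑ l, dz i (fun y => hopfMatrix n a y k l) x * (star (x l) * x k) =
      -a * star (x i) / sqNorm x ^ 2 * sqNorm x
      - (a - 4) * star (x i) / sqNorm x ^ 2 * sqNorm x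
      + 2 * (a - 4) * star (x i) / sqNorm x ^ 3 * sqNorm x ^ 2 := by
    have h : ∀ k l, dz i (fun y => hopfMatrix n a y k l) x * (star (x l) * x k) =
        (if k = l then -a * star (x i) / sqNorm x ^ 2 * (x k * star (x l)) else 0) -
        (if i = l then (a - 4) * star (x l) / sqNorm x ^ 2 * (x k * star (x k)) else 0)
        + 2 * (a - 4) * star (x i) / sqNorm x ^ 3 *
          ((x k * star (x k)) * (x l * star (x l))) := by
      intro k l
      rw [dz_hopfMatrix a hx]
      split_ifs <;> simp <;> ring
    simp only [h, Finset.sum_add_distrib, Finset.sum_sub_distrib, ← Finset.mul_sum,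
      ← Finset.sum_mul, Finset.sum_ite_eq, Finset.mem_univ, if_true, ← sqNorm_eq_sum, ← pow_two]
  rw [sum_mul_hopfMatrixInv a fun k l => dz i (fun y => hopfMatrix n a y k l) x, h1, h2]
  field_simp
  ring

/-- The trace of the `(1,0)` part of the Strominger-Bismut connection of `hopfMatrix`. -/
theorem sum_dz_hopfMatrix_mul_inv' {a : ℝ} (ha : a ≠ 0) (hx : x ≠ 0) (i : Fin n) :
    ∑ k, ∑ l, dz k (fun y => hopfMatrix n a y i l) x * hopfMatrixInv n a x l k =
      -(n - 4 * (n - 1) / a) * (star (x i) * (sqNorm x)⁻¹) := by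
  have hN := sqNorm_ne_zero hx
  have ha' : (a : ℂ) ≠ 0 := by exact_mod_cast ha
  have h1 : ∑ k, dz k (fun y => hopfMatrix n a y i k) x =
      -a * star (x i) / sqNorm x ^ 2 - (a - 4) * star (x i) / sqNorm x ^ 2 * n
      + 2 * (a - 4) * star (x i) / sqNorm x ^ 3 * sqNorm x := by
    have h : ∀ k, dz k (fun y => hopfMatrix n a y i k) x =
        (if i = k then -a * star (x k) / sqNorm x ^ 2 else 0) -
        (a - 4) * star (x i) / sqNorm x ^ 2
        + 2 * (a - 4) * star (x i) / sqNorm x ^ 3 * (x k * star (x k)) := by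
      intro k
      rw [dz_hopfMatrix a hx, if_pos (rfl : k = k)]
      split_ifs <;> ring
    simp only [h, Finset.sum_add_distrib, Finset.sum_sub_distrib, ← Finset.mul_sum,
      ← sqNorm_eq_sum]
    simp
    ring
  have h2 : ∑ k, ∑ l, dz k (fun y => hopfMatrix n a y i l) x * (star (x l) * x k) =
      -a * star (x i) / sqNorm x ^ 2 * sqNorm x
      - (a - 4) * star (x i) / sqNorm x ^ 2 * sqNorm x
      + 2 * (a - 4) * star (x i) / sqNorm x ^ 3 * sqNorm x ^ 2 := by
    have h : ∀ k l, dz k (fun y => hopfMatrix n a y i l) x * (star (x l) * x k) =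
        (if i = l then -a * star (x l) / sqNorm x ^ 2 * (x k * star (x k)) else 0) -
        (if k = l then (a - 4) * star (x i) / sqNorm x ^ 2 * (x k * star (x l)) else 0)
        + 2 * (a - 4) * star (x i) / sqNorm x ^ 3 *
          ((x k * star (x k)) * (x l * star (x l))) := by
      intro k l
      rw [dz_hopfMatrix a hx]
      split_ifs <;> simp <;> ring
    simp only [h, Finset.sum_add_distrib, Finset.sum_sub_distrib, ← Finset.mul_sum,
      ← Finset.sum_mul, Finset.sum_ite_eq, Finset.mem_univ, if_true, ← sqNorm_eq_sum, ← pow_two]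
  rw [sum_mul_hopfMatrixInv a fun k l => dz k (fun y => hopfMatrix n a y i l) x, h1, h2]
  field_simp
  ring

end HopfForm

/-! ### Symmetry of the inverse and differentiability of the coefficients. -/

section HopfForm

variable {n : ℕ} {x : Cn n}

theorem star_hopfMatrixInv (a : ℝ) (i j : Fin n) :
    star (hopfMatrixInv n a x i j) = hopfMatrixInv n a x j i := by
  simp only [hopfMatrixInv, Matrix.of_apply, star_add, star_mul', star_div₀, star_sub, star_sqNorm,
    star_star, apply_ite star, star_one, star_zero, eq_comm (a := i)]
  simp [mul_comm (x i)]

@[fun_prop]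
theorem differentiableAt_hopfMatrixInv (a : ℝ) (i j : Fin n) :
    DifferentiableAt ℝ (fun y => hopfMatrixInv n a y i j) x := by
  simp only [hopfMatrixInv, Matrix.of_apply, div_eq_mul_inv]
  fun_prop

@[fun_prop]
theorem differentiableAt_dz_hopfMatrix (a : ℝ) (hx : x ≠ 0) (k i l : Fin n) :
    DifferentiableAt ℝ (fun y => dz k (fun z => hopfMatrix n a z i l) y) x := by
  have h0 : DifferentiableAt ℝ (fun y : Cn n => (sqNorm y)⁻¹) x :=
    differentiableAt_sqNorm.inv (sqNorm_ne_zero hx)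
  refine DifferentiableAt.congr_of_eventuallyEq ?_
    ((isOpen_ne.eventually_mem hx).mono fun y hy => dz_hopfMatrix a hy k i l)
  simp only [div_eq_mul_inv, ← inv_pow]
  fun_prop

end HopfForm

/-! ### Solving for the Chern and Strominger-Bismut connections; the Ricci form as a trace. -/

namespace CoordConnection

variable {n : ℕ} {D Ch SB : CoordConnection n} {h h' : Cn n → Matrix (Fin n) (Fin n) ℂ}
  {K : Matrix (Fin n) (Fin n) ℂ} {U : Set (Cn n)} {x : Cn n}

theorem IsMetric.congr (hU : IsOpen U) (hh : Set.EqOn h h' U) (H : D.IsMetric h U) :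
    D.IsMetric h' U := by
  intro x hx i j l
  rw [← hh hx, ← H x hx i j l]
  refine dz_congr i ?_
  filter_upwards [hU.mem_nhds hx] with y hy
  rw [hh hy]

theorem IsChern.congr (hU : IsOpen U) (hh : Set.EqOn h h' U) (H : D.IsChern h U) :
    D.IsChern h' U :=
  ⟨H.1.congr hU hh, H.2⟩

theorem IsStromingerBismut.congr (hU : IsOpen U) (hh : Set.EqOn h h' U)
    (H : D.IsStromingerBismut h U) : D.IsStromingerBismut h' U := by
  refine ⟨H.1.congr hU hh, fun x hx i j l => ?_⟩
  simpa only [torsionA, torsionB, hh hx] using H.2 x hx i j l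

/-- For a fixed connection the metric only lowers and raises an index, so its value at the point is
enough. The compatibility conditions above differentiate the metric and need equality on an open
set. -/
theorem firstRicci_congr (hh : h x = h' x) : D.firstRicci h x = D.firstRicci h' x := by
  simp only [firstRicci, curvatureLow, hh]

/-- Raising an index. -/
theorem eq_sum_mul_of_sum_mul_eq {H : Matrix (Fin n) (Fin n) ℂ} (hK : H * K = 1)
    {v d : Fin n → ℂ} (hv : ∀ l, ∑ k, v k * H k l = d l) (k : Fin n) :
    v k = ∑ l, d l * K l k := by
  have h1 : Matrix.vecMul v H = d := funext hv
  have h2 : Matrix.vecMul d K = v := by rw [← h1, Matrix.vecMul_vecMul, hK, Matrix.vecMul_one]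
  exact (congrFun h2 k).symm

/-- Lowering an index. -/
theorem sum_sum_mul_mul_eq {H : Matrix (Fin n) (Fin n) ℂ} (hK : H * K = 1)
    (d : Fin n → ℂ) (l : Fin n) : ∑ k, (∑ m, d m * K m k) * H k l = d l := by
  have h2 : Matrix.vecMul (Matrix.vecMul d K) H = d := by
    rw [Matrix.vecMul_vecMul, mul_eq_one_comm.1 hK, Matrix.vecMul_one]
  exact congrFun h2 l

theorem IsChern.A_eq (H : D.IsChern h U) (hx : x ∈ U) (hK : h x * K = 1) (i j k : Fin n) :
    D.A i j k x = ∑ l, dz i (fun y => h y j l) x * K l k := by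
  refine eq_sum_mul_of_sum_mul_eq (v := fun k => D.A i j k x) hK (fun l => ?_) k
  rw [H.1 x hx i j l]
  simp [H.2 x hx]

/-- Metric compatibility and skew torsion contain the same `B` term; eliminating it leaves the Chern
formula with `i` and `j` exchanged. -/
theorem IsStromingerBismut.sum_A_mul (H : D.IsStromingerBismut h U) (hx : x ∈ U)
    (i j l : Fin n) : ∑ k, D.A i j k x * h x k l = dz j (fun y => h y i l) x := by
  have h1 := H.1 x hx j i l
  have h2 := H.2 x hx j i l
  simp only [torsionA, torsionB, sub_mul, Finset.sum_sub_distrib, mul_comm (star _)] at h2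
  rw [h1]
  linear_combination -h2

theorem IsStromingerBismut.sum_B_mul (H : D.IsStromingerBismut h U) (hx : x ∈ U)
    (i l j : Fin n) : ∑ k, h x j k * star (D.B i l k x) =
      dz i (fun y => h y j l) x - dz j (fun y => h y i l) x := by
  rw [H.1 x hx i j l, H.sum_A_mul hx i j l]
  ring

theorem IsStromingerBismut.A_eq (H : D.IsStromingerBismut h U) (hx : x ∈ U) (hK : h x * K = 1)
    (i j k : Fin n) : D.A i j k x = ∑ l, dz j (fun y => h y i l) x * K l k :=
  eq_sum_mul_of_sum_mul_eq (v := fun k => D.A i j k x) hK (H.sum_A_mul hx i j) k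

theorem IsStromingerBismut.B_eq (H : D.IsStromingerBismut h U) (hx : x ∈ U) (hK : h x * K = 1)
    (hh : ∀ i j, star (h x i j) = h x j i) (i l k : Fin n) :
    D.B i l k x =
      ∑ j, star (dz i (fun y => h y j l) x - dz j (fun y => h y i l) x) * K j k := by
  refine eq_sum_mul_of_sum_mul_eq (v := fun k => D.B i l k x) hK (fun j => ?_) k
  rw [← H.sum_B_mul hx i l j, star_sum]
  exact Finset.sum_congr rfl fun k _ => by rw [star_mul', star_star, hh, mul_comm]

theorem exists_isChern {K : Cn n → Matrix (Fin n) (Fin n) ℂ} (hK : ∀ x ∈ U, h x * K x = 1) :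
    ∃ D : CoordConnection n, D.IsChern h U := by
  refine ⟨⟨fun i j k x => ∑ l, dz i (fun y => h y j l) x * K x l k, fun _ _ _ _ => 0⟩,
    fun x hx i j l => ?_, fun _ _ _ _ _ => rfl⟩
  simp only [star_zero, mul_zero, Finset.sum_const_zero, add_zero]
  exact (sum_sum_mul_mul_eq (hK x hx) (fun l => dz i (fun y => h y j l) x) l).symm

/-- The formulas forced by `A_eq` and `B_eq` serve as the definition. Hermitian symmetry of `h` is
needed to conjugate the equation for `B`. -/
theorem exists_isStromingerBismut {K : Cn n → Matrix (Fin n) (Fin n) ℂ}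
    (hK : ∀ x ∈ U, h x * K x = 1) (hh : ∀ x ∈ U, ∀ i j, star (h x i j) = h x j i) :
    ∃ D : CoordConnection n, D.IsStromingerBismut h U := by
  let D : CoordConnection n :=
    ⟨fun i j k x => ∑ l, dz j (fun y => h y i l) x * K x l k, fun i l k x =>
      ∑ j, star (dz i (fun y => h y j l) x - dz j (fun y => h y i l) x) * K x j k⟩
  have hA : ∀ x ∈ U, ∀ i j l, ∑ k, D.A i j k x * h x k l = dz j (fun y => h y i l) x :=
    fun x hx i j l => sum_sum_mul_mul_eq (hK x hx) (fun l => dz j (fun y => h y i l) x) l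
  have hB : ∀ x ∈ U, ∀ i l j, ∑ k, h x j k * star (D.B i l k x) =
      dz i (fun y => h y j l) x - dz j (fun y => h y i l) x := by
    intro x hx i l j
    have := congrArg star (sum_sum_mul_mul_eq (hK x hx)
      (fun j => star (dz i (fun y => h y j l) x - dz j (fun y => h y i l) x)) j)
    rw [star_star, star_sum] at this
    rw [← this]
    exact Finset.sum_congr rfl fun k _ => by rw [star_mul', hh x hx, mul_comm]
  refine ⟨D, fun x hx i j l => ?_, fun x hx i j l => ?_⟩
  · rw [hA x hx, hB x hx]; ring
  · simp only [torsionA, torsionB, sub_mul, Finset.sum_sub_distrib, mul_comm (star _)]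
    rw [hA x hx, hA x hx, hB x hx]; ring

theorem nablaBar_frame (j k s : Fin n) (y : Cn n) : D.nablaBar j (frame k) y s = D.B j k s y := by
  simp [nablaBar, frame, dzbar_const, Pi.single_apply]

theorem nabla_frame (j k s : Fin n) (y : Cn n) : D.nabla j (frame k) y s = D.A j k s y := by
  simp [nabla, frame, dz_const, Pi.single_apply]

theorem curvature_eq (i j k s : Fin n) : D.curvature i j k x s =
    dz i (D.B j k s) x + ∑ m, D.B j k m x * D.A i m s x -
      (dzbar j (D.A i k s) x + ∑ m, D.A i k m x * D.B j m s x) := by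
  rw [curvature, nabla, nablaBar]
  simp only [nablaBar_frame, nabla_frame]

/-- The first Ricci form is the trace of the curvature, so the terms quadratic in the connection
coefficients cancel. -/
theorem firstRicci_apply (hK : h x * K = 1) (i j : Fin n)
    (hA : ∀ k, DifferentiableAt ℝ (D.A i k k) x) (hB : ∀ k, DifferentiableAt ℝ (D.B j k k) x) :
    D.firstRicci h x i j =
      dz i (fun y => ∑ k, D.B j k k y) x - dzbar j (fun y => ∑ k, D.A i k k y) x := by
  have hinv : (h x)⁻¹ = K := Matrix.inv_eq_right_inv hK
  -- Contracting with the inverse metric undoes the lowering and leaves the endomorphism trace.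
  have h1 : ∀ k, ∑ l, (h x)⁻¹ l k * D.curvatureLow h i j k l x = D.curvature i j k x k := by
    intro k
    have h2 : ∀ l, ∑ s, D.curvature i j k x s * h x s l = D.curvatureLow h i j k l x :=
      fun l => rfl
    rw [eq_sum_mul_of_sum_mul_eq hK h2 k, hinv]
    exact Finset.sum_congr rfl fun l _ => mul_comm _ _
  rw [firstRicci, Matrix.of_apply, Finset.sum_congr rfl fun k _ => h1 k,
    dz_sum _ _ fun k _ => hB k, dzbar_sum _ _ fun k _ => hA k]
  simp only [curvature_eq, Finset.sum_add_distrib, Finset.sum_sub_distrib]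
  -- The quadratic terms are the trace of a commutator: `tr (BA) = tr (AB)`.
  rw [Finset.sum_comm (f := fun k m => D.B j k m x * D.A i m k x)]
  simp only [mul_comm (D.B j _ _ x)]
  ring

theorem line_one : line 1 Ch SB = SB := by
  cases SB
  simp [line]

theorem IsChern.sum_A_hopfMatrix {a : ℝ} (ha : a ≠ 0) (H : D.IsChern (hopfMatrix n a) U)
    (hx : x ∈ U) (h0 : x ≠ 0) (i : Fin n) :
    ∑ k, D.A i k k x = -n * (star (x i) * (sqNorm x)⁻¹) := by
  simp only [H.A_eq hx (hopfMatrix_mul_inv ha h0)]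
  exact sum_dz_hopfMatrix_mul_inv ha h0 i

theorem IsStromingerBismut.sum_A_hopfMatrix {a : ℝ} (ha : a ≠ 0)
    (H : D.IsStromingerBismut (hopfMatrix n a) U) (hx : x ∈ U) (h0 : x ≠ 0) (i : Fin n) :
    ∑ k, D.A i k k x = -(n - 4 * (n - 1) / a) * (star (x i) * (sqNorm x)⁻¹) := by
  simp only [H.A_eq hx (hopfMatrix_mul_inv ha h0)]
  exact sum_dz_hopfMatrix_mul_inv' ha h0 i

/-- The trace of `B` is the conjugate of the Chern trace of `A` minus the Strominger-Bismut trace of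
`A`; the `n` cancels. -/
theorem IsStromingerBismut.sum_B_hopfMatrix {a : ℝ} (ha : a ≠ 0)
    (H : D.IsStromingerBismut (hopfMatrix n a) U) (hx : x ∈ U) (h0 : x ≠ 0) (j : Fin n) :
    ∑ k, D.B j k k x = -(4 * (n - 1) / a) * (x j * (sqNorm x)⁻¹) := by
  simp only [H.B_eq hx (hopfMatrix_mul_inv ha h0) (star_hopfMatrix a)]
  have h1 := sum_dz_hopfMatrix_mul_inv ha h0 j
  have h2 := sum_dz_hopfMatrix_mul_inv' ha h0 j
  have h3 : ∑ k, ∑ m, star (dz j (fun y => hopfMatrix n a y m k) x -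
        dz m (fun y => hopfMatrix n a y j k) x) * hopfMatrixInv n a x m k =
      star (∑ m, ∑ k, dz j (fun y => hopfMatrix n a y m k) x * hopfMatrixInv n a x k m -
        ∑ m, ∑ k, dz m (fun y => hopfMatrix n a y j k) x * hopfMatrixInv n a x k m) := by
    rw [Finset.sum_comm]
    simp only [← Finset.sum_sub_distrib, star_sum, ← sub_mul]
    exact Finset.sum_congr rfl fun k _ => Finset.sum_congr rfl fun m _ => by
      rw [star_mul', star_hopfMatrixInv]
  rw [h3, h1, h2]
  simp only [star_sub, star_mul', star_neg, star_div₀, star_inv₀, star_star, star_sqNorm]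
  simp
  ring

theorem IsChern.differentiableAt_A_hopfMatrix {a : ℝ} (ha : a ≠ 0) (hU : IsOpen U)
    (hU0 : (0 : Cn n) ∉ U) (H : D.IsChern (hopfMatrix n a) U) (hx : x ∈ U) (i j k : Fin n) :
    DifferentiableAt ℝ (D.A i j k) x := by
  have h0 : ∀ y ∈ U, y ≠ 0 := fun y hy h => hU0 (h ▸ hy)
  have hx0 := h0 x hx
  refine DifferentiableAt.congr_of_eventuallyEq ?_ ((hU.eventually_mem hx).mono fun y hy =>
    H.A_eq hy (hopfMatrix_mul_inv ha (h0 y hy)) i j k)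
  fun_prop (disch := assumption)

theorem IsStromingerBismut.differentiableAt_A_hopfMatrix {a : ℝ} (ha : a ≠ 0) (hU : IsOpen U)
    (hU0 : (0 : Cn n) ∉ U) (H : D.IsStromingerBismut (hopfMatrix n a) U) (hx : x ∈ U)
    (i j k : Fin n) : DifferentiableAt ℝ (D.A i j k) x := by
  have h0 : ∀ y ∈ U, y ≠ 0 := fun y hy h => hU0 (h ▸ hy)
  have hx0 := h0 x hx
  refine DifferentiableAt.congr_of_eventuallyEq ?_ ((hU.eventually_mem hx).mono fun y hy =>
    H.A_eq hy (hopfMatrix_mul_inv ha (h0 y hy)) i j k)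
  fun_prop (disch := assumption)

theorem IsStromingerBismut.differentiableAt_B_hopfMatrix {a : ℝ} (ha : a ≠ 0) (hU : IsOpen U)
    (hU0 : (0 : Cn n) ∉ U) (H : D.IsStromingerBismut (hopfMatrix n a) U) (hx : x ∈ U)
    (i j k : Fin n) : DifferentiableAt ℝ (D.B i j k) x := by
  have h0 : ∀ y ∈ U, y ≠ 0 := fun y hy h => hU0 (h ▸ hy)
  have hx0 := h0 x hx
  refine DifferentiableAt.congr_of_eventuallyEq ?_ ((hU.eventually_mem hx).mono fun y hy =>
    H.B_eq hy (hopfMatrix_mul_inv ha (h0 y hy)) (star_hopfMatrix a) i j k)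
  fun_prop (disch := assumption)

/-- The first Ricci form of the Gauduchon connection of `hopfMatrix` is a multiple of
`√-1 ∂∂̄ log |z|²`. -/
theorem firstRicci_line_hopfMatrix {a : ℝ} (t : ℝ) (ha : a ≠ 0) (hU : IsOpen U)
    (hU0 : (0 : Cn n) ∉ U) (hCh : Ch.IsChern (hopfMatrix n a) U)
    (hSB : SB.IsStromingerBismut (hopfMatrix n a) U) (hx : x ∈ U) (i j : Fin n) :
    (line t Ch SB).firstRicci (hopfMatrix n a) x i j =
      (n - 8 * t * (n - 1) / a) *
        ((if i = j then 1 else 0) / sqNorm x - star (x i) * x j / sqNorm x ^ 2) := by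
  have h0 : ∀ y ∈ U, y ≠ 0 := fun y hy h => hU0 (h ▸ hy)
  have hx0 := h0 x hx
  have hChB : ∀ y ∈ U, ∀ i j k, Ch.B i j k y = 0 := hCh.2
  rw [firstRicci_apply (hopfMatrix_mul_inv ha hx0)]
  · have hA : (fun y => ∑ k, (line t Ch SB).A i k k y) =ᶠ[nhds x]
        fun y => -(n - 4 * t * (n - 1) / a : ℂ) * (star (y i) * (sqNorm y)⁻¹) := by
      filter_upwards [hU.mem_nhds hx] with y hy
      simp only [line, Finset.sum_add_distrib, ← Finset.mul_sum,
        hCh.sum_A_hopfMatrix ha hy (h0 y hy), hSB.sum_A_hopfMatrix ha hy (h0 y hy)]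
      ring
    have hB : (fun y => ∑ k, (line t Ch SB).B j k k y) =ᶠ[nhds x]
        fun y => -(4 * t * (n - 1) / a : ℂ) * (y j * (sqNorm y)⁻¹) := by
      filter_upwards [hU.mem_nhds hx] with y hy
      simp only [line, Finset.sum_add_distrib, ← Finset.mul_sum,
        hChB y hy, hSB.sum_B_hopfMatrix ha hy (h0 y hy)]
      simp
      ring
    have hd : DifferentiableAt ℝ (fun y : Cn n => (sqNorm y)⁻¹) x :=
      differentiableAt_sqNorm.inv (sqNorm_ne_zero hx0)
    -- Both derivatives are multiples of `∂∂̄ log |z|²`, with total coefficient `-4t(n-1)/a + (n -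
    -- 4t(n-1)/a)`: the torsion contributes equally through `A` and `B`.
    rw [dz_congr i hB, dzbar_congr j hA, dz_const_mul i _ (by fun_prop),
      dzbar_const_mul j _ (by fun_prop), dz_coord_mul_inv_sqNorm hx0,
      dzbar_star_coord_mul_inv_sqNorm hx0]
    ring
  · intro k
    have h1 := hCh.differentiableAt_A_hopfMatrix ha hU hU0 hx i k k
    have h2 := hSB.differentiableAt_A_hopfMatrix ha hU hU0 hx i k k
    exact (h1.const_mul _).add (h2.const_mul _)
  · intro k
    have h1 : DifferentiableAt ℝ (Ch.B j k k) x :=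
      (differentiableAt_const 0).congr_of_eventuallyEq
        ((hU.eventually_mem hx).mono fun y hy => hChB y hy j k k)
    have h2 := hSB.differentiableAt_B_hopfMatrix ha hU hU0 hx j k k
    exact (h1.const_mul _).add (h2.const_mul _)

end CoordConnection

/-! ### Charts of the Hopf manifold and the differential of the covering map. -/

section Charts

variable {n : ℕ}

theorem ne_zero_of_mem_target {φ : OpenPartialHomeomorph (HopfManifold n) (Cn n)}
    (hφ : φ ∈ atlas (Cn n) (HopfManifold n)) {x : Cn n} (hx : x ∈ φ.target) : x ≠ 0 := by
  obtain ⟨z, rfl, -⟩ := hopf_chart_symm hφ hx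
  exact z.2

theorem symm_eq_hopfMk {φ : OpenPartialHomeomorph (HopfManifold n) (Cn n)}
    (hφ : φ ∈ atlas (Cn n) (HopfManifold n)) (z : puncturedSpace n) (hz : z.1 ∈ φ.target) :
    φ.symm z.1 = hopfMk n z := by
  obtain ⟨w, hw, h⟩ := hopf_chart_symm hφ hz
  rw [h, Subtype.ext hw]

/-- In a chart, the covering map of the Hopf manifold is locally a homothety. -/
theorem chart_hopfMk {φ : OpenPartialHomeomorph (HopfManifold n) (Cn n)}
    (hφ : φ ∈ atlas (Cn n) (HopfManifold n)) (z : puncturedSpace n)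
    (hz : hopfMk n z ∈ φ.source) :
    ∃ c : ℝ, c ≠ 0 ∧ ∀ᶠ y in nhds z.1, ∀ w : puncturedSpace n, w.1 = y →
      φ (hopfMk n w) = c • y := by
  obtain ⟨w, hw, hw'⟩ := hopf_chart_symm hφ (φ.map_source hz)
  rw [φ.left_inv hz] at hw'
  obtain ⟨g, hg⟩ : ∃ g : HopfGroup n, g • z = w := Quotient.exact hw'.symm
  obtain ⟨k, -, hk⟩ := hopfGroup_smul g
  have hc : ∀ y : Cn n, ((2⁻¹ : ℂ) ^ k) • y = ((2⁻¹ : ℝ) ^ k) • y := fun y => by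
    rw [← Complex.coe_smul]; push_cast; rfl
  have hcont : Continuous fun y : Cn n => ((2⁻¹ : ℂ) ^ k) • y := by fun_prop
  have hmem : ((2⁻¹ : ℂ) ^ k) • z.1 ∈ φ.target := by
    rw [← hk, hg, hw]; exact φ.map_source hz
  refine ⟨(2⁻¹ : ℝ) ^ k, by positivity, ?_⟩
  -- Near `z` the translate by `g` remains in the target of `φ`, so it is the coordinate of the
  -- image point.
  filter_upwards [hcont.continuousAt.preimage_mem_nhds (φ.open_target.mem_nhds hmem)]
  rintro _ hy u rfl
  have hgu : hopfMk n (g • u) = hopfMk n u := Quotient.sound ⟨g, rfl⟩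
  have hmem' : (g • u).1 ∈ φ.target := by rw [hk]; exact hy
  rw [← hgu, ← symm_eq_hopfMk hφ _ hmem', φ.right_inv hmem', hk, hc]

theorem chart_punctured_symm (z : puncturedSpace n) {y : Cn n}
    (hy : y ≠ 0) : ((chartAt (Cn n) z).symm y).1 = y := by
  have h : y ∈ (chartAt (Cn n) z).target := by
    rw [TopologicalSpace.Opens.chartAt_eq, OpenPartialHomeomorph.subtypeRestr_def]
    simp only [mfld_simps]
    exact ⟨trivial, hy⟩
  exact (chartAt (Cn n) z).right_inv h

theorem continuous_hopfMk : Continuous (hopfMk n) := continuous_quotient_mk'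

/-- The differential of the covering map and of the inverse of a chart are the same homothety in
the coordinates which identify the tangent space with `ℂⁿ`. -/
theorem hasMFDerivAt_hopfMk (z : puncturedSpace n) :
    ∃ c : ℝ, c ≠ 0 ∧ chartAt (Cn n) (hopfMk n z) (hopfMk n z) = c • z.1 ∧
      HasMFDerivAt 𝓘(ℝ, Cn n) 𝓘(ℝ, Cn n) (hopfMk n) z
        (c • ContinuousLinearMap.id ℝ (Cn n) : Cn n →L[ℝ] Cn n) ∧
      ∀ φ ∈ atlas (Cn n) (HopfManifold n), z.1 ∈ φ.target →
        HasFDerivAt (fun y => chartAt (Cn n) (hopfMk n z) (φ.symm y))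
          (c • ContinuousLinearMap.id ℝ (Cn n) : Cn n →L[ℝ] Cn n) z.1 := by
  obtain ⟨c, hc, h⟩ := chart_hopfMk (chart_mem_atlas (Cn n) (hopfMk n z)) z
    (mem_chart_source (Cn n) _)
  have hd : HasFDerivAt (fun y : Cn n => c • y)
      (c • ContinuousLinearMap.id ℝ (Cn n) : Cn n →L[ℝ] Cn n) z.1 :=
    (hasFDerivAt_id (𝕜 := ℝ) z.1).const_smul c
  refine ⟨c, hc, h.self_of_nhds z rfl, ⟨continuous_hopfMk.continuousAt, ?_⟩, fun φ hφ hz => ?_⟩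
  · refine HasFDerivAt.hasFDerivWithinAt ?_
    have hz : extChartAt 𝓘(ℝ, Cn n) z z = z.1 := rfl
    rw [hz]
    refine hd.congr_of_eventuallyEq ?_
    filter_upwards [h, isOpen_ne.mem_nhds z.2] with y hy hy0
    exact hy _ (chart_punctured_symm z hy0)
  · refine hd.congr_of_eventuallyEq ?_
    filter_upwards [h, φ.open_target.mem_nhds hz] with y hy hyt
    rw [symm_eq_hopfMk hφ ⟨y, ne_zero_of_mem_target hφ hyt⟩ hyt]
    exact hy _ rfl

/-- This identifies the coordinate fields of a chart with images of constant fields under the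
covering map. Values are compared in `Cn n` because the base points are only propositionally equal.
-/
theorem mfderiv_chart_symm {φ : OpenPartialHomeomorph (HopfManifold n) (Cn n)}
    (hφ : φ ∈ atlas (Cn n) (HopfManifold n)) (z : puncturedSpace n) (hz : z.1 ∈ φ.target)
    (v : Cn n) :
    (mfderiv 𝓘(ℝ, Cn n) 𝓘(ℝ, Cn n) φ.symm z.1 v : Cn n) =
      (mfderiv 𝓘(ℝ, Cn n) 𝓘(ℝ, Cn n) (hopfMk n) z v : Cn n) := by
  obtain ⟨c, -, -, h1, h2⟩ := hasMFDerivAt_hopfMk z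
  have h3 : HasMFDerivAt 𝓘(ℝ, Cn n) 𝓘(ℝ, Cn n) φ.symm z.1
      (c • ContinuousLinearMap.id ℝ (Cn n) : Cn n →L[ℝ] Cn n) := by
    refine ⟨(φ.continuousAt_symm hz), HasFDerivAt.hasFDerivWithinAt ?_⟩
    have h := h2 φ hφ hz
    rw [← symm_eq_hopfMk hφ z hz] at h
    exact h
  rw [h1.mfderiv, h3.mfderiv]
  rfl

end Charts

/-! ### The homothety-invariant inner product on `ℂⁿ \ {0}`. -/

section Metric

variable {n : ℕ}

theorem ContDiffAt.smul_real {E F : Type*} [NormedAddCommGroup E] [NormedSpace ℝ E]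
    [NormedAddCommGroup F] [NormedSpace ℝ F] {f : E → ℝ} {g : E → F} {x : E}
    (hf : ContDiffAt ℝ ∞ f x) (hg : ContDiffAt ℝ ∞ g x) :
    ContDiffAt ℝ ∞ (fun y => f y • g y) x :=
  hf.smul hg

/-- The inner product of a real inner product space as a continuous bilinear form. -/
noncomputable def realInnerForm (E : Type*) [NormedAddCommGroup E] [InnerProductSpace ℝ E] :
    E →L[ℝ] E →L[ℝ] ℝ :=
  innerSL ℝ

@[simp]
theorem realInnerForm_apply {E : Type*} [NormedAddCommGroup E] [InnerProductSpace ℝ E] (u v : E) :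
    realInnerForm E u v = inner ℝ u v := rfl

/-- The bilinear form `b g(u, v) - c (g(w, u) g(w, v) + g(Jw, u) g(Jw, v))` with the coefficients
`b = 2a / |w|²` and `c = 2(a - 4) / |w|⁴`. -/
noncomputable def homothetyInvariantForm {E : Type*} [NormedAddCommGroup E]
    [InnerProductSpace ℝ E] (J : E →L[ℝ] E) (a : ℝ) (w : E) : E →L[ℝ] E →L[ℝ] ℝ :=
  (2 * a / ‖w‖ ^ 2) • realInnerForm E -
    (2 * (a - 4) / (‖w‖ ^ 2) ^ 2) •
      ((realInnerForm E w).smulRight (realInnerForm E w) +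
        (realInnerForm E (J w)).smulRight (realInnerForm E (J w)))

theorem contDiffAt_homothetyInvariantForm {E : Type*} [NormedAddCommGroup E]
    [InnerProductSpace ℝ E] (J : E →L[ℝ] E) (a : ℝ) {w : E} (hw : w ≠ 0) :
    ContDiffAt ℝ ∞ (homothetyInvariantForm J a) w := by
  have h1 : ContDiff ℝ ∞ fun w : E => ‖w‖ ^ 2 := contDiff_norm_sq ℝ
  have h2 : ‖w‖ ^ 2 ≠ 0 := by simpa using hw
  have h3 : ContDiff ℝ ∞ fun w : E => realInnerForm E w :=
    (realInnerForm E).contDiff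
  have h4 : ContDiff ℝ ∞ fun w : E => realInnerForm E (J w) := h3.comp J.contDiff
  have h5 : ∀ f : E → E →L[ℝ] ℝ, ContDiff ℝ ∞ f →
      ContDiff ℝ ∞ fun w => (f w).smulRight (f w) := fun f hf => hf.smulRight hf
  exact ((contDiffAt_const.div h1.contDiffAt h2).smul_real contDiffAt_const).sub
    ((contDiffAt_const.div (h1.contDiffAt.pow 2) (pow_ne_zero 2 h2)).smul_real
      ((h5 _ h3).add (h5 _ h4)).contDiffAt)

/-- The real bilinear form `g(u, v)` with `g(√-1 u, v) = ω(u, v)`, where `ω` is the `(1,1)`-form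
with coefficients `hopfMatrix n a w`. -/
noncomputable def hopfInner (n : ℕ) (a : ℝ) (w : Cn n) : Cn n →L[ℝ] Cn n →L[ℝ] ℝ :=
  homothetyInvariantForm (Complex.I • ContinuousLinearMap.id ℝ (Cn n)) a w

theorem hopfInner_apply (a : ℝ) (w u v : Cn n) :
    hopfInner n a w u v = 2 * a / ‖w‖ ^ 2 * inner ℝ u v -
      2 * (a - 4) / (‖w‖ ^ 2) ^ 2 * (inner ℝ w u * inner ℝ w v +
        inner ℝ (Complex.I • w) u * inner ℝ (Complex.I • w) v) := by
  simp [hopfInner, homothetyInvariantForm, mul_add]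

theorem inner_real_eq_re (u v : Cn n) : inner ℝ u v = (inner ℂ u v).re := by
  simp [PiLp.inner_apply]

theorem inner_I_smul_left (u v : Cn n) : inner ℝ (Complex.I • u) v = (inner ℂ u v).im := by
  rw [inner_real_eq_re, inner_smul_left]; simp

/-- The two real inner products are the real and imaginary parts of the complex one, so this is the
complex Cauchy-Schwarz inequality. -/
theorem inner_sq_add_inner_I_sq_le (w u : Cn n) :
    inner ℝ w u ^ 2 + inner ℝ (Complex.I • w) u ^ 2 ≤ ‖w‖ ^ 2 * ‖u‖ ^ 2 := by
  rw [inner_real_eq_re, inner_I_smul_left, ← mul_pow]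
  calc _ = ‖inner ℂ w u‖ ^ 2 := by rw [Complex.sq_norm, Complex.normSq_apply]; ring
    _ ≤ _ := by gcongr; exact norm_inner_le_norm w u

theorem hopfInner_self_ge {a : ℝ} {w : Cn n} (hw : w ≠ 0) (u : Cn n) :
    2 * min a 4 / ‖w‖ ^ 2 * ‖u‖ ^ 2 ≤ hopfInner n a w u u := by
  have hN : 0 < ‖w‖ ^ 2 := by positivity
  have h := inner_sq_add_inner_I_sq_le w u
  rw [hopfInner_apply, real_inner_self_eq_norm_sq, ← sub_nonneg]
  set S := inner ℝ w u ^ 2 + inner ℝ (Complex.I • w) u ^ 2 with hS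
  have hS0 : 0 ≤ S := by positivity
  -- For `a ≤ 4` the remaining term is nonnegative because `S ≥ 0`; for `a ≥ 4` it is `(a - 4)`
  -- times the Cauchy-Schwarz defect.
  have key : 0 ≤ (a - min a 4) * (‖w‖ ^ 2 * ‖u‖ ^ 2) - (a - 4) * S := by
    rcases le_total a 4 with ha | ha
    · rw [min_eq_left ha]; nlinarith
    · rw [min_eq_right ha]; nlinarith
  have : 2 * a / ‖w‖ ^ 2 * ‖u‖ ^ 2 - 2 * (a - 4) / (‖w‖ ^ 2) ^ 2 * (inner ℝ w u * inner ℝ w u +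
        inner ℝ (Complex.I • w) u * inner ℝ (Complex.I • w) u) - 2 * min a 4 / ‖w‖ ^ 2 * ‖u‖ ^ 2 =
      2 / (‖w‖ ^ 2) ^ 2 * ((a - min a 4) * (‖w‖ ^ 2 * ‖u‖ ^ 2) - (a - 4) * S) := by
    rw [hS]; field_simp; ring
  rw [this]
  positivity

/-- Each term has degree zero under simultaneous scaling of `w`, `u`, `v`. This makes the form
descend, since chart changes are homotheties. -/
theorem hopfInner_smul (a : ℝ) {c : ℝ} (hc : c ≠ 0) (w u v : Cn n) :
    hopfInner n a (c • w) (c • u) (c • v) = hopfInner n a w u v := by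
  have h : Complex.I • c • w = c • Complex.I • w := smul_comm _ _ _
  simp only [hopfInner_apply, h, real_inner_smul_left, real_inner_smul_right, norm_smul, mul_pow,
    Real.norm_eq_abs, sq_abs]
  rcases eq_or_ne w 0 with rfl | hw
  · simp
  · have : ‖w‖ ≠ 0 := by simpa using hw
    field_simp

theorem hopfInner_I_smul (a : ℝ) (w u v : Cn n) :
    hopfInner n a w (Complex.I • u) (Complex.I • v) = hopfInner n a w u v := by
  simp only [hopfInner_apply, inner_real_eq_re, inner_smul_right, inner_smul_left, Complex.conj_I,
    Complex.mul_re, Complex.mul_im, Complex.neg_re, Complex.neg_im, Complex.I_re, Complex.I_im]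
  ring

/-- Each summand pairs with its conjugate: the double sum is a difference of conjugates, hence
`2√-1` times an imaginary part, and the prefactor `√-1` makes it real. -/
theorem oneOneForm_hopfMatrix (a : ℝ) (w u v : Cn n) :
    oneOneForm (hopfMatrix n a w) u v = (hopfInner n a w (Complex.I • u) v : ℝ) := by
  have h1 : ∑ i, ∑ j, hopfMatrix n a w i j * (u i * star (v j) - v i * star (u j)) =
      a * (sqNorm w)⁻¹ * (inner ℂ v u - inner ℂ u v) - (a - 4) * (sqNorm w)⁻¹ ^ 2 *
        (inner ℂ w u * star (inner ℂ w v) - inner ℂ w v * star (inner ℂ w u)) := by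
    have h : ∀ i j, hopfMatrix n a w i j * (u i * star (v j) - v i * star (u j)) =
        (if i = j then a * (sqNorm w)⁻¹ * (u i * star (v j) - v i * star (u j)) else 0) -
        (a - 4) * (sqNorm w)⁻¹ ^ 2 * ((u i * star (w i)) * (w j * star (v j)) -
          (v i * star (w i)) * (w j * star (u j))) := by
      intro i j
      simp only [hopfMatrix, Matrix.of_apply]
      split_ifs <;> ring
    rw [Finset.sum_congr rfl fun i _ => Finset.sum_congr rfl fun j _ => h i j]
    simp only [Finset.sum_sub_distrib, ← Finset.mul_sum, ← Finset.sum_mul, Finset.sum_ite_eq,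
      Finset.mem_univ, if_true, PiLp.inner_apply, RCLike.inner_apply', star_sum, star_mul',
      RCLike.star_def, Complex.conj_conj]
    simp only [mul_comm]
  have h2 := Complex.sub_conj (inner ℂ v u)
  have h3 := Complex.sub_conj (inner ℂ w u * star (inner ℂ w v))
  rw [inner_conj_symm] at h2
  rw [map_mul, RCLike.star_def, Complex.conj_conj, mul_comm _ (inner ℂ w v)] at h3
  rw [oneOneForm, h1, RCLike.star_def, h2, h3, hopfInner_apply, inner_I_smul_left,
    inner_I_smul_left,
    inner_real_eq_re w, inner_real_eq_re w, inner_I_smul_left, inner_smul_right,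
    ← inner_conj_symm u v]
  have hN : sqNorm w = ((‖w‖ ^ 2 : ℝ) : ℂ) := rfl
  simp only [Complex.mul_im, Complex.mul_re, Complex.conj_re, Complex.conj_im, Complex.I_re,
    Complex.I_im, hN]
  push_cast
  linear_combination (a * ((‖w‖ : ℂ) ^ 2)⁻¹ * 2 * (inner ℂ v u).im - (a - 4) *
    ((‖w‖ : ℂ) ^ 2)⁻¹ ^ 2 * 2 * ((inner ℂ w u).im * (inner ℂ w v).re -
      (inner ℂ w u).re * (inner ℂ w v).im)) * Complex.I_sq

theorem contDiffAt_hopfInner (a : ℝ) {w : Cn n} (hw : w ≠ 0) :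
    ContDiffAt ℝ ∞ (hopfInner n a) w :=
  contDiffAt_homothetyInvariantForm _ a hw

theorem isVonNBounded_hopfInner {a : ℝ} (ha : 0 < a) {w : Cn n} (hw : w ≠ 0) :
    Bornology.IsVonNBounded ℝ {v : Cn n | hopfInner n a w v v < 1} := by
  rw [NormedSpace.isVonNBounded_iff]
  have hN : 0 < ‖w‖ ^ 2 := by positivity
  have hm : 0 < min a 4 := lt_min ha (by norm_num)
  set b := 2 * min a 4 / ‖w‖ ^ 2 with hb
  have hb0 : 0 < b := by positivity
  refine isBounded_iff_forall_norm_le.2 ⟨1 + b⁻¹, fun v hv => ?_⟩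
  have h1 : b * ‖v‖ ^ 2 < 1 := (hopfInner_self_ge hw v).trans_lt hv
  have h2 : ‖v‖ ^ 2 < b⁻¹ := by rw [inv_eq_one_div, lt_div_iff₀ hb0]; linarith
  -- Since `2‖v‖ ≤ 1 + ‖v‖²`, the radius `1 + b⁻¹` works without a square root.
  nlinarith [sq_nonneg (‖v‖ - 1), norm_nonneg v]

end Metric

/-! ### The metric on the Hopf manifold: smoothness, uniqueness, coefficients in charts. -/

section Metric

variable {n : ℕ}

theorem hopfInner_comm (a : ℝ) (w u v : Cn n) :
    hopfInner n a w u v = hopfInner n a w v u := by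
  rw [hopfInner_apply, hopfInner_apply, real_inner_comm]
  ring

theorem hopfInner_self_pos {a : ℝ} (ha : 0 < a) {w v : Cn n} (hw : w ≠ 0) (hv : v ≠ 0) :
    0 < hopfInner n a w v v := by
  refine lt_of_lt_of_le ?_ (hopfInner_self_ge hw v)
  have : 0 < min a 4 := lt_min ha (by norm_num)
  positivity

theorem chart_self_ne_zero (p : HopfManifold n) : chartAt (Cn n) p p ≠ 0 :=
  ne_zero_of_mem_target (chart_mem_atlas _ p)
    ((chartAt (Cn n) p).map_source (mem_chart_source _ p))

/-- The preferred chart `chartAt p` may jump with `p`, so smoothness is not visible from the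
formula. In the trivialization at `p₀` the coordinate change is a homothety, and invariance replaces
the varying chart by the fixed chart at `p₀`. -/
theorem contMDiff_hopfInner (a : ℝ) :
    ContMDiff 𝓘(ℝ, Cn n) (𝓘(ℝ, Cn n).prod 𝓘(ℝ, Cn n →L[ℝ] Cn n →L[ℝ] ℝ)) ∞
      (fun p : HopfManifold n => Bundle.TotalSpace.mk' (Cn n →L[ℝ] Cn n →L[ℝ] ℝ)
        (E := fun p : HopfManifold n => TangentSpace 𝓘(ℝ, Cn n) p →L[ℝ]
          TangentSpace 𝓘(ℝ, Cn n) p →L[ℝ] ℝ) p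
        (hopfInner n a (chartAt (Cn n) p p))) := by
  intro p₀
  refine (Bundle.contMDiffAt_section _).2 ?_
  have h0 : chartAt (Cn n) p₀ p₀ ≠ 0 := chart_self_ne_zero p₀
  have h1 : ContMDiffAt 𝓘(ℝ, Cn n) 𝓘(ℝ, Cn n →L[ℝ] Cn n →L[ℝ] ℝ) ∞
      (fun p => hopfInner n a (chartAt (Cn n) p₀ p)) p₀ :=
    ContMDiffAt.comp p₀ (contDiffAt_hopfInner a h0).contMDiffAt
      (contMDiffAt_of_mem_maximalAtlas (IsManifold.chart_mem_maximalAtlas p₀)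
        (mem_chart_source _ p₀))
  refine h1.congr_of_eventuallyEq ?_
  filter_upwards [(chartAt (Cn n) p₀).open_source.mem_nhds (mem_chart_source _ p₀)] with p hp
  set w := chartAt (Cn n) p₀ p with hw
  have hwt : w ∈ (chartAt (Cn n) p₀).target := (chartAt (Cn n) p₀).map_source hp
  set z : puncturedSpace n := ⟨w, ne_zero_of_mem_target (chart_mem_atlas _ p₀) hwt⟩
  have hz : p = hopfMk n z := by
    rw [← symm_eq_hopfMk (chart_mem_atlas _ p₀) z hwt]
    exact ((chartAt (Cn n) p₀).left_inv hp).symm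
  obtain ⟨c, hc, hcz, -, hd⟩ := hasMFDerivAt_hopfMk z
  rw [← hz] at hcz hd
  -- The inverse trivialization is the derivative of the transition from the chart at `p₀` to the
  -- chart at `p`, i.e. multiplication by `c`.
  have hsymm : (trivializationAt (Cn n) (TangentSpace 𝓘(ℝ, Cn n)) p₀).symmL ℝ p =
      (c • ContinuousLinearMap.id ℝ (Cn n) : Cn n →L[ℝ] Cn n) := by
    rw [TangentBundle.symmL_trivializationAt_eq_core hp]
    have := (hd _ (chart_mem_atlas _ p₀) hwt).fderiv
    rw [tangentBundleCore_coordChange_achart, ModelWithCorners.range_eq_univ, fderivWithin_univ]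
    exact this
  ext u v
  rw [hom_trivializationAt_apply]
  have h2 : ∀ u : Cn n, ((trivializationAt (Cn n) (TangentSpace 𝓘(ℝ, Cn n)) p₀).symm p u : Cn n) =
      c • u := by
    intro u
    have := congrArg (fun L : Cn n →L[ℝ] Cn n => L u) hsymm
    rw [← Bundle.Trivialization.symmL_apply (R := ℝ) _ hp]
    exact this
  have h3 := inCoordinates_apply_eq₂ (x₀ := p₀) (x := p)
    (F₁ := Cn n) (E₁ := fun p : HopfManifold n => TangentSpace 𝓘(ℝ, Cn n) p)
    (F₂ := Cn n) (E₂ := fun p : HopfManifold n => TangentSpace 𝓘(ℝ, Cn n) p)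
    (F₃ := ℝ) (E₃ := Bundle.Trivial (HopfManifold n) ℝ)
    (ϕ := hopfInner n a (chartAt (Cn n) p p)) (v := u) (w := v) hp hp (Set.mem_univ _)
  refine h3.trans ?_
  rw [h2, h2, hcz]
  simp
  exact hopfInner_smul a hc w u v


/-- The Hermitian metric on the Hopf manifold induced by `hopfMatrix n a`, for `a > 0`. -/
noncomputable def hopfMetric (n : ℕ) {a : ℝ} (ha : 0 < a) : HermitianMetric n (HopfManifold n) where
  inner p := hopfInner n a (chartAt (Cn n) p p)
  symm _ u v := hopfInner_comm a _ u v
  pos p _ hv := hopfInner_self_pos ha (chart_self_ne_zero p) hv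
  isVonNBounded p := isVonNBounded_hopfInner ha (chart_self_ne_zero p)
  contMDiff := contMDiff_hopfInner a
  inner_J _ u v := hopfInner_I_smul a _ u v

theorem complexJ_mfderiv_hopfMk (z : puncturedSpace n) (u : Cn n) :
    complexJ (hopfMk n z) (mfderiv 𝓘(ℝ, Cn n) 𝓘(ℝ, Cn n) (hopfMk n) z u) =
      mfderiv 𝓘(ℝ, Cn n) 𝓘(ℝ, Cn n) (hopfMk n) z (Complex.I • u : Cn n) := by
  obtain ⟨c, -, -, h, -⟩ := hasMFDerivAt_hopfMk z
  rw [h.mfderiv]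
  exact smul_comm Complex.I c u

theorem complexJ_complexJ (p : HopfManifold n) (u : TangentSpace 𝓘(ℝ, Cn n) p) :
    complexJ p (complexJ p u) = -u := by
  have h : ∀ u : Cn n, Complex.I • Complex.I • u = -u := fun u => by
    rw [smul_smul, Complex.I_mul_I, neg_one_smul]
  exact h u

theorem isHopfMetric_hopfMetric {c : ℝ} (h : 0 < 4 + c) : IsHopfMetric (hopfMetric n h) c := by
  intro z u v
  obtain ⟨k, hk, hkz, h1, -⟩ := hasMFDerivAt_hopfMk z
  have h2 : ∀ u : Cn n, (mfderiv 𝓘(ℝ, Cn n) 𝓘(ℝ, Cn n) (hopfMk n) z u : Cn n) = k • u := fun u => by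
    rw [h1.mfderiv]
    rfl
  have h3 : ∀ u v : Cn n, (hopfMetric n h).fundamentalForm (hopfMk n z)
      (mfderiv 𝓘(ℝ, Cn n) 𝓘(ℝ, Cn n) (hopfMk n) z u)
      (mfderiv 𝓘(ℝ, Cn n) 𝓘(ℝ, Cn n) (hopfMk n) z v) =
      hopfInner n (4 + c) z.1 (Complex.I • u) v := by
    intro u v
    rw [HermitianMetric.fundamentalForm, complexJ_mfderiv_hopfMk]
    change hopfInner n (4 + c) (chartAt (Cn n) (hopfMk n z) (hopfMk n z)) _ _ = _
    rw [h2, h2 v, hkz]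
    exact hopfInner_smul (4 + c) hk _ _ _
  rw [hopfCoeff_eq_hopfMatrix c z.2]
  exact (congrArg Complex.ofReal (h3 u v)).trans (oneOneForm_hopfMatrix (4 + c) z.1 u v).symm

theorem surjective_mfderiv_hopfMk (z : puncturedSpace n) :
    Function.Surjective (mfderiv 𝓘(ℝ, Cn n) 𝓘(ℝ, Cn n) (hopfMk n) z) := by
  obtain ⟨c, hc, -, h, -⟩ := hasMFDerivAt_hopfMk z
  rw [h.mfderiv]
  intro u
  exact ⟨(c⁻¹ • (u : Cn n) : Cn n), smul_inv_smul₀ hc (u : Cn n)⟩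

/-- The covering map is surjective on points and on tangent vectors, and `g(X, Y) = ω(-JX, Y)`, so
the pulled-back form determines the metric. -/
theorem IsHopfMetric.unique {g g' : HermitianMetric n (HopfManifold n)} {c : ℝ}
    (h : IsHopfMetric g c) (h' : IsHopfMetric g' c) : g = g' := by
  have key : g.inner = g'.inner := by
    funext p
    obtain ⟨z, rfl⟩ : ∃ z, hopfMk n z = p := Quotient.exists_rep p
    ext u v
    obtain ⟨u', hu⟩ := surjective_mfderiv_hopfMk z (-complexJ _ u)
    obtain ⟨v', rfl⟩ := surjective_mfderiv_hopfMk z v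
    have h2 := (h z u' v').trans (h' z u' v').symm
    rw [hu] at h2
    simpa [HermitianMetric.fundamentalForm, complexJ_complexJ] using h2
  obtain ⟨⟨_, _, _, _, _⟩, _⟩ := g
  obtain ⟨⟨_, _, _, _, _⟩, _⟩ := g'
  cases key
  rfl

theorem IsHopfMetric.inner_eq {g : HermitianMetric n (HopfManifold n)} {c : ℝ}
    (h : IsHopfMetric g c) (z : puncturedSpace n) (u v : Cn n) :
    (g.inner (hopfMk n z) (mfderiv 𝓘(ℝ, Cn n) 𝓘(ℝ, Cn n) (hopfMk n) z u)
      (mfderiv 𝓘(ℝ, Cn n) 𝓘(ℝ, Cn n) (hopfMk n) z v) : ℂ) =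
      oneOneForm (hopfMatrix n (4 + c) z.1) (-(Complex.I • u)) v := by
  have e := h z (-(Complex.I • u) : Cn n) v
  rw [hopfCoeff_eq_hopfMatrix c z.2, HermitianMetric.fundamentalForm,
    complexJ_mfderiv_hopfMk] at e
  rwa [smul_neg, smul_smul, Complex.I_mul_I, neg_one_smul, neg_neg] at e

theorem oneOneForm_single (H : Matrix (Fin n) (Fin n) ℂ) (i j : Fin n) (b d : ℂ) :
    oneOneForm H (EuclideanSpace.single i b) (EuclideanSpace.single j d) =
      Complex.I * (H i j * b * star d - H j i * d * star b) := by
  have h : ∀ k l, H k l * ((EuclideanSpace.single i b : Cn n) k *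
      star ((EuclideanSpace.single j d : Cn n) l) - (EuclideanSpace.single j d : Cn n) k *
      star ((EuclideanSpace.single i b : Cn n) l)) =
      (if k = i then if l = j then H k l * b * star d else 0 else 0) -
      (if k = j then if l = i then H k l * d * star b else 0 else 0) := by
    intro k l
    simp only [PiLp.single_apply]
    split_ifs <;> simp <;> ring
  rw [oneOneForm, Finset.sum_congr rfl fun k _ => Finset.sum_congr rfl fun l _ => h k l]
  simp [Finset.sum_sub_distrib]

theorem IsHopfMetric.coeff_eq {g : HermitianMetric n (HopfManifold n)} {c : ℝ}
    (h : IsHopfMetric g c) {φ : OpenPartialHomeomorph (HopfManifold n) (Cn n)}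
    (hφ : φ ∈ atlas (Cn n) (HopfManifold n)) {x : Cn n} (hx : x ∈ φ.target) :
    g.coeff φ x = hopfMatrix n (4 + c) x := by
  obtain ⟨z, rfl⟩ : ∃ z : puncturedSpace n, z.1 = x := ⟨⟨x, ne_zero_of_mem_target hφ hx⟩, rfl⟩
  ext i j
  -- The base point is generalized so that the equality `φ.symm z = hopfMk n z` can be substituted
  -- despite the dependent tangent spaces.
  have key : ∀ p (_ : p = hopfMk n z) (u v : TangentSpace 𝓘(ℝ, Cn n) p) (u' v' : Cn n),
      (u : Cn n) = (mfderiv 𝓘(ℝ, Cn n) 𝓘(ℝ, Cn n) (hopfMk n) z u' : Cn n) →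
      (v : Cn n) = (mfderiv 𝓘(ℝ, Cn n) 𝓘(ℝ, Cn n) (hopfMk n) z v' : Cn n) →
      (g.inner p u v : ℂ) = oneOneForm (hopfMatrix n (4 + c) z.1) (-(Complex.I • u')) v' ∧
      (g.inner p u (complexJ p v) : ℂ) =
        oneOneForm (hopfMatrix n (4 + c) z.1) (-(Complex.I • u')) (Complex.I • v') := by
    rintro p rfl u v u' v' rfl rfl
    exact ⟨h.inner_eq z u' v', by rw [complexJ_mfderiv_hopfMk]; exact h.inner_eq z u' _⟩
  obtain ⟨h1, h2⟩ := key _ (symm_eq_hopfMk hφ z hx) (HermitianMetric.coordVector φ z.1 i)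
    (HermitianMetric.coordVector φ z.1 j) _ _ (mfderiv_chart_symm hφ z hx _)
    (mfderiv_chart_symm hφ z hx _)
  have h3 : ∀ (b : ℂ) (i : Fin n), (b • EuclideanSpace.single i (1 : ℂ) : Cn n) =
      EuclideanSpace.single i b := by
    intro b i
    ext k
    simp [PiLp.single_apply]
  rw [HermitianMetric.coeff, Matrix.of_apply, h1, h2, ← neg_smul, h3, h3, oneOneForm_single,
    oneOneForm_single]
  simp
  linear_combination (-hopfMatrix n (4 + c) z.1 i j + Complex.I ^ 2 *
    (hopfMatrix n (4 + c) z.1 i j - hopfMatrix n (4 + c) z.1 j i) / 2) * Complex.I_sq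

end Metric

/-! ### Vanishing of the Ricci forms. -/

section RicciFlat

variable {n : ℕ} {g : HermitianMetric n (HopfManifold n)}
  {φ : OpenPartialHomeomorph (HopfManifold n) (Cn n)}

theorem IsHopfMetric.exists_isChern {c : ℝ} (h : IsHopfMetric g c) (hc : 4 + c ≠ 0)
    (hφ : φ ∈ atlas (Cn n) (HopfManifold n)) :
    ∃ D : CoordConnection n, D.IsChern (g.coeff φ) φ.target :=
  CoordConnection.exists_isChern fun x hx => by
    rw [h.coeff_eq hφ hx]
    exact hopfMatrix_mul_inv hc (ne_zero_of_mem_target hφ hx)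

theorem IsHopfMetric.exists_isStromingerBismut {c : ℝ} (h : IsHopfMetric g c) (hc : 4 + c ≠ 0)
    (hφ : φ ∈ atlas (Cn n) (HopfManifold n)) :
    ∃ D : CoordConnection n, D.IsStromingerBismut (g.coeff φ) φ.target :=
  CoordConnection.exists_isStromingerBismut
    (fun x hx => by
      rw [h.coeff_eq hφ hx]
      exact hopfMatrix_mul_inv hc (ne_zero_of_mem_target hφ hx))
    fun x hx i j => by rw [h.coeff_eq hφ hx, star_hopfMatrix]

theorem IsHopfMetric.firstRicci_line_eq_zero {c t : ℝ} (h : IsHopfMetric g c) (hc : 4 + c ≠ 0)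
    (hn : (n : ℝ) * (4 + c) = 8 * t * (n - 1)) (hφ : φ ∈ atlas (Cn n) (HopfManifold n))
    {Ch SB : CoordConnection n} (hCh : Ch.IsChern (g.coeff φ) φ.target)
    (hSB : SB.IsStromingerBismut (g.coeff φ) φ.target) {x : Cn n} (hx : x ∈ φ.target) :
    (CoordConnection.line t Ch SB).firstRicci (g.coeff φ) x = 0 := by
  have hh : Set.EqOn (g.coeff φ) (hopfMatrix n (4 + c)) φ.target := fun y hy => h.coeff_eq hφ hy
  rw [CoordConnection.firstRicci_congr (hh hx)]
  ext i j
  rw [CoordConnection.firstRicci_line_hopfMatrix t hc φ.open_target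
    (fun h0 => ne_zero_of_mem_target hφ h0 rfl) (hCh.congr φ.open_target hh)
    (hSB.congr φ.open_target hh) hx]
  -- `hn` says exactly that the coefficient of `∂∂̄ log |z|²` is zero.
  have h1 : ((n : ℂ) - 8 * t * (n - 1) / (4 + c : ℝ)) = 0 := by
    have h2 : ((4 + c : ℝ) : ℂ) ≠ 0 := by exact_mod_cast hc
    rw [sub_eq_zero, eq_div_iff h2]
    exact_mod_cast hn
  rw [h1, zero_mul, Matrix.zero_apply]

theorem oneOneForm_zero (u v : Cn n) : oneOneForm (0 : Matrix (Fin n) (Fin n) ℂ) u v = 0 := by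
  simp [oneOneForm]

theorem IsHopfMetric.isGauduchonRicciFlat {c t : ℝ} (h : IsHopfMetric g c) (hc : 4 + c ≠ 0)
    (hn : (n : ℝ) * (4 + c) = 8 * t * (n - 1)) : g.IsGauduchonRicciFlat t := by
  refine fun φ hφ => ⟨h.exists_isChern hc hφ, h.exists_isStromingerBismut hc hφ,
    fun Ch SB hCh hSB x hx u v => ?_⟩
  rw [h.firstRicci_line_eq_zero hc hn hφ hCh hSB hx, oneOneForm_zero]

theorem IsHopfMetric.isStromingerBismutRicciFlat {c : ℝ} (h : IsHopfMetric g c) (hc : 4 + c ≠ 0)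
    (hn : (n : ℝ) * (4 + c) = 8 * (n - 1)) : g.IsStromingerBismutRicciFlat := by
  refine fun φ hφ => ⟨h.exists_isStromingerBismut hc hφ, fun SB hSB x hx u v => ?_⟩
  -- Any Chern connection serves to view the given connection as the `t = 1` point of the line,
  -- where it has weight zero.
  obtain ⟨Ch, hCh⟩ := h.exists_isChern hc hφ
  have := h.firstRicci_line_eq_zero (t := 1) hc (by rw [hn]; ring) hφ hCh hSB hx
  rw [CoordConnection.line_one] at this
  rw [this, oneOneForm_zero]

end RicciFlat

/-- On the standard Hopf manifold of dimension `n ≥ 2`, for every `t > 0` the form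
`ω_t = ω₀ + 4 (2(n-1)t/n - 1) √-1 ∂∂̄ log |z|²` is the fundamental form of a (unique) Hermitian
metric, and this metric is `t`-Gauduchon-Ricci flat. For `t = 1` it is Strominger-Bismut-Ricci
flat. -/
theorem theorem1p9 (n : ℕ) (hn : 2 ≤ n) :
    (∀ t : ℝ, 0 < t →
      (∃! g : HermitianMetric n (HopfManifold n),
        IsHopfMetric g (4 * (2 * ((n : ℝ) - 1) * t / n - 1))) ∧
      ∀ g : HermitianMetric n (HopfManifold n),
        IsHopfMetric g (4 * (2 * ((n : ℝ) - 1) * t / n - 1)) → g.IsGauduchonRicciFlat t) ∧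
    ∀ g : HermitianMetric n (HopfManifold n),
      IsHopfMetric g (4 * (2 * ((n : ℝ) - 1) / n - 1)) → g.IsStromingerBismutRicciFlat := by
  have hn2 : (2 : ℝ) ≤ n := by exact_mod_cast hn
  have hn0 : (0 : ℝ) < n := by linarith
  have hn1 : (0 : ℝ) < n - 1 := by linarith
  -- With `s = 2(n-1)t/n` this is `a = 8(n-1)t/n`, which gives both positivity and `n a = 8t(n-1)`.
  have hc : ∀ s : ℝ, 4 + 4 * (s - 1) = 4 * s := fun s => by ring
  refine ⟨fun t ht => ?_, fun g hg => ?_⟩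
  · have hpos : 0 < 4 + 4 * (2 * ((n : ℝ) - 1) * t / n - 1) := by rw [hc]; positivity
    refine ⟨⟨hopfMetric n hpos, isHopfMetric_hopfMetric hpos, fun g hg =>
      hg.unique (isHopfMetric_hopfMetric hpos)⟩, fun g hg => hg.isGauduchonRicciFlat hpos.ne' ?_⟩
    rw [hc]
    field_simp
    ring
  · have hpos : 0 < 4 + 4 * (2 * ((n : ℝ) - 1) / n - 1) := by rw [hc]; positivity
    refine hg.isStromingerBismutRicciFlat hpos.ne' ?_
    rw [hc]
    field_simp
    ring
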